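/- Let $r\ge 3$ be an integer. For $p_0\in(0,1)$ consider the system of differential equations, for positive functions $\hat w,\hat b,\hat q,\hat s,\hat t$ on $[0,\infty)$, $$\hat w'=-r\hat s,\qquad \hat b'=-\hat b-r\hat t+r\hat s,\qquad \hat q'=-\frac{(2r-2)\hat q\hat s}{\hat w},$$ $$\hat s'=-\hat s+\frac{(r-1)\hat q\hat s}{\hat w}-\frac{(r-1)\hat s^2}{\hat w}-\frac{r(r-2)\hat s\hat t}{(r-1)\hat b},\qquad \hat t'=-2\hat t+\frac{2(r-1)\hat s^2}{\hat w}-\frac{2r(r-2)\hat t^2}{(r-1)\hat b},$$ with $\hat w(0)=(1-p_0)^{r+1}$, $\hat b(0)=rp_0(1-p_0)^r$, $\hat q(0)=(1-p_0)^{2r}$, $\hat s(0)=(r-1)p_0(1-p_0)^{2r-1}$, $\hat t(0)=(r-1)^2p_0^2(1-p_0)^{2r-2}$. Put $$\xi(r,p_0)=p_0(1-p_0)^r+\int_0^\infty\hat b(x)\,dx+\begin{cases}\lim_{x\to\infty}\hat w(x)&\text{if }\lim_{x\to\infty}\frac{(r-1)\hat q(x)}{\hat w(x)}<1,\\0&\text{otherwise,}\end{cases}\qquad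 \xi(r)=\sup_{0<p_0<1}\xi(r,p_0).$$ For a finite simple graph $G$ let $\tau(G)$ be the maximum number of vertices of an induced forest (an acyclic induced subgraph) of $G$; the girth of $G$ is the length of a shortest cycle, and $\infty$ if $G$ is acyclic. Then the following hold. 1. For every $p_0\in(0,1)$ the number $\xi(r,p_0)$ is well defined (a positive solution on $[0,\infty)$ exists, the integral and the limits converge, and the value does not depend on the choice of the solution), and the supremum $\xi(r)$ is finite. 2. For every $\delta>0$ there is an integer $g>0$, depending only on $\delta$ and $r$, such that every graph $G$ on $n$ vertices with maximum degree at most $r$ and girth at least $g$ satisfies $\tau(G)\ge(\xi(r)-\delta)n$. 3. For $r=3,4,\dots,10$ let $c_r$ be, respectively, $0.7268,\ 0.6045,\ 0.5269,\ 0.4711,\ 0.4283,\ 0.3940,\ 0.3658,\ 0.3419$. For each such $r$ there is $p_0\in(0,1)$ with $c_r\le\xi(r,p_0)<c_r+10^{-4}$; in particular $\xi(r)\ge c_r$. -/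

import Mathlib

open Set Filter Topology MeasureTheory

noncomputable section

namespace InducedForest

/-- `τ(G)`: the maximum number of vertices of an induced forest of `G`, i.e. of an acyclic
induced subgraph. -/
def tau {V : Type*} [Fintype V] (G : SimpleGraph V) : ℕ :=
  sSup {k : ℕ | ∃ S : Finset V, (G.induce (S : Set V)).IsAcyclic ∧ S.card = k}

/-- `(w, b, q, s, t)` is a positive solution, on the whole half-line `[0, ∞)`, of the system of
differential equations associated with `(r, p₀)`. -/
structure IsSolution (r : ℕ) (p₀ : ℝ) (w b q s t : ℝ → ℝ) : Prop where
  pos : ∀ x, 0 ≤ x → 0 < w x ∧ 0 < b x ∧ 0 < q x ∧ 0 < s x ∧ 0 < t x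
  deriv_w : ∀ x, 0 ≤ x → HasDerivWithinAt w (-(r : ℝ) * s x) (Ici 0) x
  deriv_b : ∀ x, 0 ≤ x → HasDerivWithinAt b (-b x - r * t x + r * s x) (Ici 0) x
  deriv_q : ∀ x, 0 ≤ x →
    HasDerivWithinAt q (-((2 * (r : ℝ) - 2) * q x * s x / w x)) (Ici 0) x
  deriv_s : ∀ x, 0 ≤ x →
    HasDerivWithinAt s
      (-s x + ((r : ℝ) - 1) * q x * s x / w x - ((r : ℝ) - 1) * s x ^ 2 / w x
        - (r : ℝ) * ((r : ℝ) - 2) * s x * t x / (((r : ℝ) - 1) * b x)) (Ici 0) x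
  deriv_t : ∀ x, 0 ≤ x →
    HasDerivWithinAt t
      (-2 * t x + 2 * ((r : ℝ) - 1) * s x ^ 2 / w x
        - 2 * (r : ℝ) * ((r : ℝ) - 2) * t x ^ 2 / (((r : ℝ) - 1) * b x)) (Ici 0) x
  init_w : w 0 = (1 - p₀) ^ (r + 1)
  init_b : b 0 = r * p₀ * (1 - p₀) ^ r
  init_q : q 0 = (1 - p₀) ^ (2 * r)
  init_s : s 0 = ((r : ℝ) - 1) * p₀ * (1 - p₀) ^ (2 * r - 1)
  init_t : t 0 = ((r : ℝ) - 1) ^ 2 * p₀ ^ 2 * (1 - p₀) ^ (2 * r - 2)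

/-- `c` is the constant `ξ(r, p₀)`: with the solution of the system associated with `(r, p₀)`,
it is `p₀ (1 - p₀)^r + ∫₀^∞ b + lim w` if `lim (r - 1) q / w < 1`, and
`p₀ (1 - p₀)^r + ∫₀^∞ b` otherwise; convergence of the integral and of the two limits is
part of the definition. -/
def IsXi (r : ℕ) (p₀ c : ℝ) : Prop :=
  ∃ w b q s t : ℝ → ℝ, IsSolution r p₀ w b q s t ∧ IntegrableOn b (Ioi 0) ∧
    ∃ wlim ρ : ℝ, Tendsto w atTop (𝓝 wlim) ∧
      Tendsto (fun x => ((r : ℝ) - 1) * q x / w x) atTop (𝓝 ρ) ∧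
      c = p₀ * (1 - p₀) ^ r + (∫ x in Ioi (0 : ℝ), b x) + (if ρ < 1 then wlim else 0)

/-- The set of all constants `ξ(r, p₀)` with `0 < p₀ < 1`. -/
def xiValues (r : ℕ) : Set ℝ :=
  {c | ∃ p₀ ∈ Ioo (0 : ℝ) 1, IsXi r p₀ c}

/-- `ξ(r)`: the best of the constants `ξ(r, p₀)`, i.e. their supremum over `0 < p₀ < 1`. -/
def xi (r : ℕ) : ℝ := sSup (xiValues r)

/-- The tabulated numerical values, for `3 ≤ r ≤ 10` (the value elsewhere is not used). -/
def tableXi : ℕ → ℝ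
  | 3 => 0.7268
  | 4 => 0.6045
  | 5 => 0.5269
  | 6 => 0.4711
  | 7 => 0.4283
  | 8 => 0.3940
  | 9 => 0.3658
  | 10 => 0.3419
  | _ => 0

end InducedForest

end

noncomputable section

namespace InducedForest

/-! The system integrates in closed form. Let `f` be the probability that a branch hanging from a
vertex is unexplored, and `h` the probability that it is explored while the coin of the vertex has
not come up since. Then `f' = -rate(f) h` and `h' = -h + rate(f) h`, and the solution is `w = (1-p)
f^r`, `b = (1-p) r f^(r-1) h`, `q = (1-p)^2 f^(2r-2)`, `s = (1-p) f^(r-1) rate(f) h`, `t = (rate(f)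
h)^2`. Dividing the two equations gives `dh/df = 1/rate(f) - 1`, so `h = profile(f)`, and `f`
decreases from `1-p` to the zero `φ` of the profile. Since `b = -(r/(r-1)) f f'`, the integral of
`b` is elementary; and `(r-1) q / w = rate(f)` tends to `rate(φ) < 1`, so the limit of `w` is always
counted (`isXi_xiVal`). Uniqueness is that of a locally Lipschitz equation, and the table reduces to
bracketing `φ`.

For the forests, time is discretized with step `ε` and the vertices are explored at random: at time
`0` with probability `p`, later with probability `ε` per step while exactly one neighbour is
explored. A vertex is kept if no neighbour has a coin at the same moment. Vertices which at the end
are unexplored with no explored neighbour (white) are added unless they start a long white path. In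
a finite set of minimum degree two, either a white vertex would start arbitrarily long white paths,
or the vertex explored last would have had two explored neighbours; so the chosen set induces a
forest (`isAcyclic_chosen`).

When the girth exceeds the range of the process, the branches at a vertex depend on disjoint sets of
coordinates. Missing neighbours are simulated with the same law, so every branch survives with
exactly the discretized probability, whatever the graph (`survLaw`). Each further step of a white
path costs a factor `rate(f) < 1`, so long ones are rare. The expected density of the forest is then
at least `density`, which is close to `xiVal` for small `ε` (`exists_density_ge`), and some outcome
is at least as good as the mean (`density_mul_card_le_tau`). -/

/-- The rate at which an exposed branch is explored when its surviving fraction is `f`. -/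
def rate (r : ℕ) (p f : ℝ) : ℝ := (1 - p) * ((r : ℝ) - 1) * f ^ (r - 2)

/-- The first integral of the system: the value of the auxiliary function `h` when the
surviving fraction is `f`. -/
def profile (r : ℕ) (p f : ℝ) : ℝ := 1 - f - ∫ x in f..(1 - p), (rate r p x)⁻¹

/-- The closed form of `ξ(r, p)` in terms of the zero `φ` of the profile. -/
def xiVal (r : ℕ) (p φ : ℝ) : ℝ :=
  p * (1 - p) ^ r + (r : ℝ) / (2 * ((r : ℝ) - 1)) * ((1 - p) ^ 2 - φ ^ 2) + (1 - p) * φ ^ r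

/-! ### The first integral and its zero -/

section profile

variable {r : ℕ} {p : ℝ}

lemma two_le_cast_sub_one (hr : 3 ≤ r) : (2 : ℝ) ≤ (r : ℝ) - 1 := by
  have : (3 : ℝ) ≤ r := by exact_mod_cast hr
  linarith

lemma rate_pos (hr : 3 ≤ r) (hp : p < 1) {f : ℝ} (hf : 0 < f) : 0 < rate r p f := by
  have := two_le_cast_sub_one hr
  have : 0 < 1 - p := by linarith
  unfold rate
  positivity

lemma rate_lt_rate (hr : 3 ≤ r) (hp : p < 1) {f g : ℝ} (hf : 0 ≤ f) (hfg : f < g) :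
    rate r p f < rate r p g := by
  have h1 := two_le_cast_sub_one hr
  have h2 : 0 < 1 - p := by linarith
  unfold rate
  exact mul_lt_mul_of_pos_left (pow_lt_pow_left₀ hfg hf (by omega)) (by positivity)

lemma rate_le_rate (hr : 3 ≤ r) (hp : p < 1) {f g : ℝ} (hf : 0 ≤ f) (hfg : f ≤ g) :
    rate r p f ≤ rate r p g := by
  rcases hfg.eq_or_lt with rfl | h
  · rfl
  · exact (rate_lt_rate hr hp hf h).le

/-- The exponent `r - 2` is at least one, so a linear bound is available for every `r`. It makes `∫
1 / rate` diverge at least logarithmically at zero, and it keeps a discrete step from consuming the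
whole surviving fraction. -/
lemma rate_le_mul (hr : 3 ≤ r) (hp0 : 0 ≤ p) {f : ℝ} (hf : 0 ≤ f) (hf1 : f ≤ 1) :
    rate r p f ≤ ((r : ℝ) - 1) * f := by
  have h1 := two_le_cast_sub_one hr
  have h2 : f ^ (r - 2) ≤ f := by
    simpa using pow_le_pow_of_le_one hf hf1 (show 1 ≤ r - 2 by omega)
  have h3 : 0 ≤ f ^ (r - 2) := by positivity
  unfold rate
  calc (1 - p) * ((r : ℝ) - 1) * f ^ (r - 2) ≤ 1 * ((r : ℝ) - 1) * f ^ (r - 2) := by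
        gcongr; linarith
    _ ≤ 1 * ((r : ℝ) - 1) * f := by gcongr
    _ = _ := by ring

lemma continuous_rate : Continuous (rate r p) := by
  unfold rate; fun_prop

lemma continuousOn_rate_inv (hr : 3 ≤ r) (hp : p < 1) :
    ContinuousOn (fun x => (rate r p x)⁻¹) (Ioi 0) :=
  continuous_rate.continuousOn.inv₀ fun _ hx => (rate_pos hr hp hx).ne'

lemma intervalIntegrable_rate_inv (hr : 3 ≤ r) (hp : p < 1) {a b : ℝ} (ha : 0 < a) (hb : 0 < b) :
    IntervalIntegrable (fun x => (rate r p x)⁻¹) volume a b := by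
  apply ContinuousOn.intervalIntegrable
  apply (continuousOn_rate_inv hr hp).mono
  intro x hx
  exact lt_of_lt_of_le (lt_min ha hb) hx.1

lemma hasDerivAt_profile (hr : 3 ≤ r) (hp : p < 1) {f : ℝ} (hf : 0 < f) :
    HasDerivAt (profile r p) (-1 + (rate r p f)⁻¹) f := by
  have h2 : 0 < 1 - p := by linarith
  have hc : ContinuousAt (fun x => (rate r p x)⁻¹) f :=
    (continuousOn_rate_inv hr hp).continuousAt (Ioi_mem_nhds hf)
  have h := intervalIntegral.integral_hasDerivAt_left (intervalIntegrable_rate_inv hr hp hf h2)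
    ((continuousOn_rate_inv hr hp).stronglyMeasurableAtFilter isOpen_Ioi f hf) hc
  have h' : HasDerivAt (profile r p) (-1 - -(rate r p f)⁻¹) f :=
    ((hasDerivAt_id f).const_sub 1).sub h
  simpa using h'

lemma profile_init : profile r p (1 - p) = p := by simp [profile]

lemma continuousOn_profile (hr : 3 ≤ r) (hp : p < 1) : ContinuousOn (profile r p) (Ioi 0) :=
  fun _ hx => (hasDerivAt_profile hr hp hx).continuousAt.continuousWithinAt

lemma profile_le_log (hr : 3 ≤ r) (hp0 : 0 ≤ p) (hp : p < 1) {f : ℝ} (hf : 0 < f)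
    (hf1 : f ≤ 1 - p) :
    profile r p f ≤ 1 - f - ((r : ℝ) - 1)⁻¹ * Real.log ((1 - p) / f) := by
  have h1 := two_le_cast_sub_one hr
  have h2 : 0 < 1 - p := by linarith
  have : ∫ x in f..(1 - p), ((r : ℝ) - 1)⁻¹ * x⁻¹ = ((r : ℝ) - 1)⁻¹ * Real.log ((1 - p) / f) := by
    rw [intervalIntegral.integral_const_mul, integral_inv_of_pos hf h2]
  rw [← this, profile]
  refine sub_le_sub_left (intervalIntegral.integral_mono_on hf1 ?_
    (intervalIntegrable_rate_inv hr hp hf h2) ?_) _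
  · apply ContinuousOn.intervalIntegrable
    refine continuousOn_const.mul (continuousOn_inv₀.mono ?_)
    intro x hx
    exact (lt_of_lt_of_le (lt_min hf h2) hx.1).ne'
  · intro x hx
    have hx0 : 0 < x := hf.trans_le hx.1
    rw [← mul_inv]
    exact inv_anti₀ (rate_pos hr hp hx0) (rate_le_mul hr hp0 hx0.le (by linarith [hx.2]))

lemma exists_profile_eq_zero (hr : 3 ≤ r) (hp0 : 0 < p) (hp : p < 1) :
    ∃ φ, 0 < φ ∧ φ < 1 - p ∧ profile r p φ = 0 := by
  have h1 := two_le_cast_sub_one hr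
  have h2 : 0 < 1 - p := by linarith
  -- At this point the logarithm in `profile_le_log` equals `r`, and `r / (r - 1) > 1` beats the
  -- remaining term `1 - a`.
  set a := (1 - p) * Real.exp (-(r : ℝ)) with ha
  have ha0 : 0 < a := by positivity
  have ha1 : a < 1 - p := by
    have : Real.exp (-(r : ℝ)) < 1 := by
      rw [Real.exp_lt_one_iff]; linarith
    nlinarith
  have hneg : profile r p a < 0 := by
    have h := profile_le_log hr hp0.le hp ha0 ha1.le
    have : (1 - p) / a = Real.exp r := by
      rw [ha, Real.exp_neg]; field_simp
    rw [this, Real.log_exp] at h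
    have : 1 < ((r : ℝ) - 1)⁻¹ * r := by
      rw [inv_mul_eq_div, lt_div_iff₀ (by linarith)]; linarith
    linarith
  have hcont : ContinuousOn (profile r p) (Icc a (1 - p)) :=
    (continuousOn_profile hr hp).mono fun x hx => ha0.trans_le hx.1
  obtain ⟨φ, hφ, h0⟩ := intermediate_value_Ioo ha1.le hcont
    (show (0 : ℝ) ∈ Ioo (profile r p a) (profile r p (1 - p)) from ⟨hneg, by rwa [profile_init]⟩)
  exact ⟨φ, ha0.trans hφ.1, hφ.2, h0⟩

variable {φ : ℝ}

/-- Otherwise the derivative `-1 + 1 / rate` would be negative to the right of `φ`, and the profile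
could not climb from `0` to `p`. This is what decides the case distinction in `ξ(r, p)`. -/
lemma rate_zero_lt_one (hr : 3 ≤ r) (hp0 : 0 < p) (hp : p < 1) (hφ0 : 0 < φ) (hφ1 : φ < 1 - p)
    (hφ : profile r p φ = 0) : rate r p φ < 1 := by
  by_contra! hge
  have hanti : StrictAntiOn (profile r p) (Icc φ (1 - p)) := by
    apply strictAntiOn_of_deriv_neg (convex_Icc _ _)
    · exact (continuousOn_profile hr hp).mono fun x hx => hφ0.trans_le hx.1
    · intro x hx
      rw [interior_Icc] at hx
      rw [(hasDerivAt_profile hr hp (hφ0.trans hx.1)).deriv]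
      have : 1 < rate r p x := hge.trans_lt (rate_lt_rate hr hp hφ0.le hx.1)
      have := inv_lt_one_of_one_lt₀ this
      linarith
  have := hanti (left_mem_Icc.2 hφ1.le) (right_mem_Icc.2 hφ1.le) hφ1
  rw [profile_init, hφ] at this
  linarith

lemma profile_strictMonoOn (hr : 3 ≤ r) (hp0 : 0 < p) (hp : p < 1) (hφ0 : 0 < φ)
    (hφ1 : φ < 1 - p) (hφ : profile r p φ = 0) : StrictMonoOn (profile r p) (Ioc 0 φ) := by
  apply strictMonoOn_of_deriv_pos (convex_Ioc _ _)
  · exact (continuousOn_profile hr hp).mono fun x hx => hx.1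
  · intro x hx
    rw [interior_Ioc] at hx
    rw [(hasDerivAt_profile hr hp hx.1).deriv]
    have h1 : rate r p x < 1 :=
      (rate_lt_rate hr hp hx.1.le hx.2).trans (rate_zero_lt_one hr hp0 hp hφ0 hφ1 hφ)
    have := (one_lt_inv₀ (rate_pos hr hp hx.1)).2 h1
    linarith

lemma profile_concaveOn (hr : 3 ≤ r) (hp : p < 1) : ConcaveOn ℝ (Ioi 0) (profile r p) := by
  apply AntitoneOn.concaveOn_of_deriv (convex_Ioi _) (continuousOn_profile hr hp)
  · rw [interior_Ioi]
    exact fun x hx => (hasDerivAt_profile hr hp hx).differentiableAt.differentiableWithinAt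
  · rw [interior_Ioi]
    intro x hx y hy hxy
    rw [(hasDerivAt_profile hr hp hx).deriv, (hasDerivAt_profile hr hp hy).deriv]
    have := inv_anti₀ (rate_pos hr hp hx) (rate_le_rate hr hp (le_of_lt hx) hxy)
    linarith

/-- By concavity the graph lies above the chord from `(φ, 0)` to `(1 - p, p)`. -/
lemma profile_pos (hr : 3 ≤ r) (hp0 : 0 < p) (hp : p < 1) (hφ0 : 0 < φ) (hφ1 : φ < 1 - p)
    (hφ : profile r p φ = 0) {f : ℝ} (hf : φ < f) (hf1 : f ≤ 1 - p) : 0 < profile r p f := by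
  have hd : 0 < 1 - p - φ := by linarith
  have h := (profile_concaveOn hr hp).2 (show φ ∈ Ioi (0 : ℝ) from hφ0)
    (show 1 - p ∈ Ioi (0 : ℝ) from hφ0.trans hφ1)
    (show 0 ≤ (1 - p - f) / (1 - p - φ) from div_nonneg (by linarith) hd.le)
    (show 0 ≤ (f - φ) / (1 - p - φ) from div_nonneg (by linarith) hd.le)
    (by field_simp; ring)
  have e : (1 - p - f) / (1 - p - φ) * φ + (f - φ) / (1 - p - φ) * (1 - p) = f := by
    field_simp; ring
  simp only [smul_eq_mul, hφ, profile_init, mul_zero, zero_add] at h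
  rw [e] at h
  refine lt_of_lt_of_le ?_ h
  have : 0 < f - φ := by linarith
  positivity

/-- A bound for the profile above its zero that is linear in the distance to the zero. -/
lemma profile_le_linear (hr : 3 ≤ r) (hp : p < 1) (hφ0 : 0 < φ)
    (hφ : profile r p φ = 0) {f : ℝ} (hf : φ ≤ f) :
    profile r p f ≤ (rate r p φ)⁻¹ * (f - φ) := by
  have hbd : ∀ x ∈ interior (Icc φ f), deriv (profile r p) x ≤ (rate r p φ)⁻¹ := by
    intro x hx
    rw [interior_Icc] at hx
    rw [(hasDerivAt_profile hr hp (hφ0.trans hx.1)).deriv]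
    have := inv_anti₀ (rate_pos hr hp hφ0) (rate_le_rate hr hp hφ0.le hx.1.le)
    linarith
  have h := (convex_Icc φ f).image_sub_le_mul_sub_of_deriv_le
    ((continuousOn_profile hr hp).mono fun x hx => hφ0.trans_le hx.1)
    (fun x hx => by
      rw [interior_Icc] at hx
      exact (hasDerivAt_profile hr hp (hφ0.trans hx.1)).differentiableAt.differentiableWithinAt)
    hbd φ (left_mem_Icc.2 hf) f (right_mem_Icc.2 hf) hf
  linarith

/-- Sign changes of the profile bracket its zero. -/
lemma profile_zero_mem_Ioo (hr : 3 ≤ r) (hp0 : 0 < p) (hp : p < 1) (hφ0 : 0 < φ)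
    (hφ1 : φ < 1 - p) (hφ : profile r p φ = 0) {lo hi : ℝ} (hlo1 : lo ≤ 1 - p)
    (hlo : profile r p lo < 0) (hhi0 : 0 < hi) (hhi : 0 < profile r p hi) : φ ∈ Ioo lo hi := by
  constructor
  · by_contra! h
    rcases h.eq_or_lt with rfl | h
    · linarith
    · linarith [profile_pos hr hp0 hp hφ0 hφ1 hφ h hlo1]
  · by_contra! h
    have := (profile_strictMonoOn hr hp0 hp hφ0 hφ1 hφ).monotoneOn ⟨hhi0, h⟩ ⟨hφ0, le_rfl⟩ h
    linarith

end profile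

/-! ### Solving the system explicitly -/

/-- An autonomous scalar equation with a continuous, negative and bounded right-hand side has a
global solution, which tends to `-∞`. -/
lemma exists_decreasing_solution {Φ : ℝ → ℝ} (hc : Continuous Φ) {M : ℝ} (hpos : ∀ x, 0 < Φ x)
    (hM : ∀ x, Φ x ≤ M) (z₀ : ℝ) :
    ∃ z : ℝ → ℝ, z 0 = z₀ ∧ (∀ x, HasDerivAt z (-Φ (z x)) x) ∧ Tendsto z atTop atBot := by
  have hMpos : 0 < M := (hpos 0).trans_le (hM 0)
  have hci : Continuous fun x => (Φ x)⁻¹ := hc.inv₀ fun x => (hpos x).ne'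
  -- Separation of variables: `X` is elapsed time up to sign. Its slope is at least `1 / M`, so it
  -- is a bijection of the line, and its inverse run backwards is the solution.
  set X : ℝ → ℝ := fun z => ∫ x in z₀..z, (Φ x)⁻¹ with hX
  have hd : ∀ z, HasDerivAt X (Φ z)⁻¹ z := fun z =>
    intervalIntegral.integral_hasDerivAt_right (hci.intervalIntegrable _ _)
      (hci.stronglyMeasurableAtFilter _ _) hci.continuousAt
  have hXc : Continuous X := continuous_iff_continuousAt.2 fun z => (hd z).continuousAt
  have hmono : StrictMono X := strictMono_of_deriv_pos fun z => by
    rw [(hd z).deriv]; exact inv_pos.2 (hpos z)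
  have hX0 : X z₀ = 0 := by simp [hX]
  have hmono' : Monotone fun z => X z - M⁻¹ * z := by
    have hd' : ∀ z, HasDerivAt (fun z => X z - M⁻¹ * z) ((Φ z)⁻¹ - M⁻¹ * 1) z := fun z =>
      (hd z).sub ((hasDerivAt_id z).const_mul _)
    apply monotone_of_deriv_nonneg (fun z => (hd' z).differentiableAt)
    intro z
    rw [(hd' z).deriv]
    have := inv_anti₀ (hpos z) (hM z)
    linarith
  have htop : Tendsto X atTop atTop := by
    refine tendsto_atTop_mono' _ ?_ (tendsto_atTop_add_const_right _ (-(M⁻¹ * z₀))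
      (tendsto_id.const_mul_atTop (inv_pos.2 hMpos)))
    filter_upwards [eventually_ge_atTop z₀] with z hz
    have := hmono' hz
    simp only [hX0, id] at this ⊢
    linarith
  have hbot : Tendsto X atBot atBot := by
    refine tendsto_atBot_mono' _ ?_ (tendsto_atBot_add_const_right _ (-(M⁻¹ * z₀))
      (tendsto_id.const_mul_atBot (inv_pos.2 hMpos)))
    filter_upwards [eventually_le_atBot z₀] with z hz
    have := hmono' hz
    simp only [hX0, id] at this ⊢
    linarith
  let e : ℝ ≃o ℝ := hmono.orderIsoOfSurjective X (hXc.surjective htop hbot)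
  have he : ∀ x, X (e.symm x) = x := fun x => e.apply_symm_apply x
  have hy : ∀ x, HasDerivAt e.symm (Φ (e.symm x)) x := fun x => by
    have := HasDerivAt.of_local_left_inverse (f := X) (g := e.symm) (a := x)
      e.symm.continuous.continuousAt (hd _) (inv_pos.2 (hpos _)).ne' (Eventually.of_forall he)
    simpa using this
  refine ⟨fun x => e.symm (-x), ?_, fun x => ?_, ?_⟩
  · have : e z₀ = 0 := hX0
    simpa using (e.symm_apply_eq).2 this.symm
  · exact ((hy (-x)).comp x (hasDerivAt_neg x)).congr_deriv (by ring)
  · exact e.symm.tendsto_atBot.comp tendsto_neg_atTop_atBot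

variable {r : ℕ} {p φ : ℝ}

/-- The surviving fraction as a function of time. -/
lemma exists_surviving_fraction (hr : 3 ≤ r) (hp0 : 0 < p) (hp : p < 1) (hφ0 : 0 < φ)
    (hφ1 : φ < 1 - p) (hφ : profile r p φ = 0) :
    ∃ f : ℝ → ℝ, f 0 = 1 - p ∧ (∀ x, 0 ≤ x → φ < f x ∧ f x ≤ 1 - p) ∧
      (∀ x, 0 ≤ x → HasDerivAt f (-(rate r p (f x) * profile r p (f x))) x) ∧
      Tendsto f atTop (𝓝 φ) := by
  have hd : 0 < 1 - p - φ := by linarith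
  set z₀ := Real.log (1 - p - φ)
  have hz₀ : Real.exp z₀ = 1 - p - φ := Real.exp_log hd
  -- Writing `f = φ + exp z` sends the equilibrium `φ` to `-∞`, and the equation for `z` has a
  -- bounded right-hand side because the profile is at most linear in `f - φ`. The truncation at
  -- `z₀` only serves to define that right-hand side on the whole line; it is inactive since `z`
  -- decreases from `z₀`.
  set g : ℝ → ℝ := fun z => φ + Real.exp (min z z₀) with hg
  have hgc : Continuous g := by fun_prop
  have hgφ : ∀ z, φ < g z := fun z => by have := Real.exp_pos (min z z₀); simp only [hg]; linarith
  have hg1 : ∀ z, g z ≤ 1 - p := fun z => by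
    have := Real.exp_le_exp.2 (min_le_right z z₀)
    simp only [hg]; linarith
  have hpc : Continuous fun z => profile r p (g z) :=
    (continuousOn_profile hr hp).comp_continuous hgc fun z => hφ0.trans (hgφ z)
  set Φ : ℝ → ℝ := fun z => rate r p (g z) * profile r p (g z) / Real.exp (min z z₀) with hΦ
  have hΦc : Continuous Φ := by
    refine ((continuous_rate.comp hgc).mul hpc).div (by fun_prop) fun z => (Real.exp_pos _).ne'
  have hΦpos : ∀ z, 0 < Φ z := fun z =>
    div_pos (mul_pos (rate_pos hr hp (hφ0.trans (hgφ z)))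
      (profile_pos hr hp0 hp hφ0 hφ1 hφ (hgφ z) (hg1 z))) (Real.exp_pos _)
  have hΦM : ∀ z, Φ z ≤ rate r p (1 - p) * (rate r p φ)⁻¹ := fun z => by
    rw [hΦ, div_le_iff₀ (Real.exp_pos _), mul_assoc]
    have h1 := profile_le_linear hr hp hφ0 hφ (hgφ z).le
    have h2 : g z - φ = Real.exp (min z z₀) := by simp [hg]
    rw [h2] at h1
    exact mul_le_mul (rate_le_rate hr hp (hφ0.trans (hgφ z)).le (hg1 z)) h1
      (profile_pos hr hp0 hp hφ0 hφ1 hφ (hgφ z) (hg1 z)).le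
      (rate_pos hr hp (hφ0.trans hφ1)).le
  obtain ⟨z, hz0, hzd, hzt⟩ := exists_decreasing_solution hΦc hΦpos hΦM z₀
  have hanti : Antitone z := antitone_of_deriv_nonpos (fun x => (hzd x).differentiableAt)
    fun x => by rw [(hzd x).deriv]; linarith [hΦpos (z x)]
  have hzle : ∀ x, 0 ≤ x → z x ≤ z₀ := fun x hx => hz0 ▸ hanti hx
  have hgz : ∀ x, 0 ≤ x → g (z x) = φ + Real.exp (z x) := fun x hx => by
    simp [hg, min_eq_left (hzle x hx)]
  refine ⟨fun x => φ + Real.exp (z x), ?_, fun x hx => ?_, fun x hx => ?_, ?_⟩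
  · simp [hz0, hz₀]
  · have h := hgz x hx
    dsimp only
    rw [← h]
    exact ⟨hgφ _, hg1 _⟩
  · have h := ((hzd x).exp).const_add φ
    refine h.congr_deriv ?_
    simp only [hΦ, hgz x hx, min_eq_left (hzle x hx)]
    field_simp
  · simpa using (Real.tendsto_exp_atBot.comp hzt).const_add φ

/-- All five functions are monomials in `f`, `rate f` and `h = profile f`, so the equations follow
from those of `f` and `h`. The integral comes from the primitive `-(r / (2 (r - 1))) f ^ 2` of `b`,
and `(r - 1) q / w` is `rate f`. -/
lemma isXi_xiVal (hr : 3 ≤ r) (hp0 : 0 < p) (hp : p < 1) (hφ0 : 0 < φ)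
    (hφ1 : φ < 1 - p) (hφ : profile r p φ = 0) : IsXi r p (xiVal r p φ) := by
  obtain ⟨f, hf0, hf, hfd, hft⟩ := exists_surviving_fraction hr hp0 hp hφ0 hφ1 hφ
  obtain ⟨n, rfl⟩ : ∃ n, r = n + 3 := ⟨r - 3, by omega⟩
  have hq : 0 < 1 - p := by linarith
  have hfpos : ∀ x, 0 ≤ x → 0 < f x := fun x hx => hφ0.trans (hf x hx).1
  have hHpos : ∀ x, 0 ≤ x → 0 < profile (n + 3) p (f x) := fun x hx =>
    profile_pos hr hp0 hp hφ0 hφ1 hφ (hf x hx).1 (hf x hx).2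
  have hrate : ∀ y, rate (n + 3) p y = (1 - p) * (n + 2) * y ^ (n + 1) := fun y => by
    simp only [rate, show n + 3 - 2 = n + 1 by omega]; push_cast; ring
  have hhd : ∀ x, 0 ≤ x → HasDerivAt (fun x => profile (n + 3) p (f x))
      ((-1 + (rate (n + 3) p (f x))⁻¹) *
        -(rate (n + 3) p (f x) * profile (n + 3) p (f x))) x := fun x hx =>
    (hasDerivAt_profile hr hp (hfpos x hx)).comp x (hfd x hx)
  set h : ℝ → ℝ := fun x => profile (n + 3) p (f x) with hh
  set b : ℝ → ℝ := fun x => (1 - p) * (n + 3) * f x ^ (n + 2) * h x with hb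
  have hbd : ∀ x, 0 ≤ x → HasDerivAt (fun x => -(((n : ℝ) + 3) / (2 * (n + 2))) * f x ^ 2)
      (b x) x := fun x hx => by
    have := ((hfd x hx).pow 2).const_mul (-(((n : ℝ) + 3) / (2 * (n + 2))))
    refine this.congr_deriv ?_
    rw [hrate, hb]
    simp only [hh]
    field_simp
    norm_num
    ring
  have hbpos : ∀ x, 0 ≤ x → 0 < b x := fun x hx => by
    have := hfpos x hx
    have := hHpos x hx
    simp only [hb]; positivity
  have htend : Tendsto (fun x => -(((n : ℝ) + 3) / (2 * (n + 2))) * f x ^ 2) atTop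
      (𝓝 (-(((n : ℝ) + 3) / (2 * (n + 2))) * φ ^ 2)) := (hft.pow 2).const_mul _
  have hint := integrableOn_Ioi_deriv_of_nonneg' (a := 0) (fun x hx => hbd x hx)
    (fun x hx => (hbpos x (le_of_lt hx)).le) htend
  have hval := integral_Ioi_of_hasDerivAt_of_nonneg' (a := 0) (fun x hx => hbd x hx)
    (fun x hx => (hbpos x (le_of_lt hx)).le) htend
  refine ⟨fun x => (1 - p) * f x ^ (n + 3), b, fun x => (1 - p) ^ 2 * f x ^ (2 * (n + 2)),
    fun x => (1 - p) * f x ^ (n + 2) * (rate (n + 3) p (f x) * h x),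
    fun x => (rate (n + 3) p (f x) * h x) ^ 2, ?_, hint, (1 - p) * φ ^ (n + 3),
    rate (n + 3) p φ, (hft.pow _).const_mul _, ?_, ?_⟩
  · have hds : ∀ x, 0 ≤ x → HasDerivAt (fun x => rate (n + 3) p (f x) * h x)
      (-((1 - p) * (n + 2) * (n + 1) * f x ^ n * (rate (n + 3) p (f x) * h x) * h x)
        - rate (n + 3) p (f x) * h x + rate (n + 3) p (f x) ^ 2 * h x) x := fun x hx => by
      have h1 : HasDerivAt (fun x => rate (n + 3) p (f x))
          ((1 - p) * (n + 2) * ((n + 1 : ℕ) * f x ^ n * -(rate (n + 3) p (f x) * h x))) x := by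
        simp only [hrate]
        have := ((hfd x hx).pow (n + 1)).const_mul ((1 - p) * ((n : ℝ) + 2))
        refine this.congr_deriv ?_
        simp only [hrate, hh, Nat.add_sub_cancel]
      have hne : rate (n + 3) p (f x) ≠ 0 := (rate_pos hr hp (hfpos x hx)).ne'
      refine (h1.mul (hhd x hx)).congr_deriv ?_
      simp only [hh]
      field_simp
      push_cast
      ring
    constructor
    · intro x hx
      have h1 := hfpos x hx
      have h2 := hHpos x hx
      have h3 := hbpos x hx
      have h4 := rate_pos hr hp h1
      exact ⟨by positivity, h3, by positivity, by simp only [hh]; positivity,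
        by simp only [hh]; positivity⟩
    · intro x hx
      have := (((hfd x hx).pow (n + 3)).const_mul (1 - p)).hasDerivWithinAt (s := Ici 0)
      refine this.congr_deriv ?_
      simp only [hh, show n + 3 - 1 = n + 2 by omega]
      push_cast
      ring
    · intro x hx
      have := ((((hfd x hx).pow (n + 2)).mul (hhd x hx)).const_mul
        ((1 - p) * ((n : ℝ) + 3))).hasDerivWithinAt (s := Ici 0)
      have hfx := hfpos x hx
      have hne : rate (n + 3) p (f x) ≠ 0 := (rate_pos hr hp hfx).ne'
      have hb' : b = fun x => (1 - p) * (n + 3) * (f ^ (n + 2) * h) x := by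
        funext y; simp [hb, mul_assoc]
      rw [hb']
      refine this.congr_deriv ?_
      · simp only [hh, Pi.pow_apply, Pi.mul_apply, show n + 2 - 1 = n + 1 by omega]
        have e1 : (-1 + (rate (n + 3) p (f x))⁻¹) *
            -(rate (n + 3) p (f x) * profile (n + 3) p (f x)) =
            rate (n + 3) p (f x) * profile (n + 3) p (f x) - profile (n + 3) p (f x) := by
          field_simp; ring
        rw [e1, hrate]
        push_cast
        ring
    · intro x hx
      have hfx := hfpos x hx
      have := (((hfd x hx).pow (2 * (n + 2))).const_mul ((1 - p) ^ 2)).hasDerivWithinAt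
        (s := Ici 0)
      refine this.congr_deriv ?_
      simp only [hh, hrate, show 2 * (n + 2) - 1 = 2 * n + 3 by omega]
      push_cast
      field_simp
      ring
    · intro x hx
      have hfx := hfpos x hx
      have hhx := hHpos x hx
      have := ((((hfd x hx).pow (n + 2)).const_mul (1 - p)).mul (hds x hx)).hasDerivWithinAt
        (s := Ici 0)
      refine this.congr_deriv ?_
      simp only [hb, hh, hrate, Pi.pow_apply, show n + 2 - 1 = n + 1 by omega]
      push_cast
      rw [show (n : ℝ) + 3 - 1 = n + 2 by ring]
      field_simp
      ring
    · intro x hx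
      have hfx := hfpos x hx
      have hhx := hHpos x hx
      have := ((hds x hx).pow 2).hasDerivWithinAt (s := Ici 0)
      refine this.congr_deriv ?_
      simp only [hb, hh, hrate]
      push_cast
      rw [show (n : ℝ) + 3 - 1 = n + 2 by ring]
      field_simp
      ring
    · simp only [hf0]; ring
    · simp only [hb, hh, hf0, profile_init]; push_cast; ring
    · simp only [hf0]; ring
    · simp only [hh, hf0, profile_init, hrate, show 2 * (n + 3) - 1 = 2 * n + 5 by omega]
      push_cast; ring
    · simp only [hh, hf0, profile_init, hrate, show 2 * (n + 3) - 2 = 2 * n + 4 by omega]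
      push_cast; ring
  · have := (continuous_rate (r := n + 3) (p := p)).tendsto φ |>.comp hft
    refine this.congr' ?_
    filter_upwards [eventually_ge_atTop 0] with x hx
    have hfx := hfpos x hx
    simp only [Function.comp, hrate]
    push_cast
    field_simp
    ring
  · rw [if_pos (rate_zero_lt_one hr hp0 hp hφ0 hφ1 hφ), hval, xiVal, hf0]
    push_cast
    have : ((n : ℝ) + 3 - 1) = n + 2 := by ring
    rw [this]
    ring

/-! ### Uniqueness, and finiteness of the supremum -/

/-- The right-hand side of the system, on the quintuples `(w, b, q, s, t)`. -/
def field (r : ℕ) (y : ℝ × ℝ × ℝ × ℝ × ℝ) : ℝ × ℝ × ℝ × ℝ × ℝ :=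
  (-(r : ℝ) * y.2.2.2.1,
    -y.2.1 - r * y.2.2.2.2 + r * y.2.2.2.1,
    -((2 * (r : ℝ) - 2) * y.2.2.1 * y.2.2.2.1 / y.1),
    -y.2.2.2.1 + ((r : ℝ) - 1) * y.2.2.1 * y.2.2.2.1 / y.1
      - ((r : ℝ) - 1) * y.2.2.2.1 ^ 2 / y.1
      - (r : ℝ) * ((r : ℝ) - 2) * y.2.2.2.1 * y.2.2.2.2 / (((r : ℝ) - 1) * y.2.1),
    -2 * y.2.2.2.2 + 2 * ((r : ℝ) - 1) * y.2.2.2.1 ^ 2 / y.1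
      - 2 * (r : ℝ) * ((r : ℝ) - 2) * y.2.2.2.2 ^ 2 / (((r : ℝ) - 1) * y.2.1))

lemma locallyLipschitzOn_field (hr : 3 ≤ r) :
    LocallyLipschitzOn {y : ℝ × ℝ × ℝ × ℝ × ℝ | 0 < y.1 ∧ 0 < y.2.1} (field r) := by
  have h1 := two_le_cast_sub_one hr
  have hconv : Convex ℝ {y : ℝ × ℝ × ℝ × ℝ × ℝ | 0 < y.1 ∧ 0 < y.2.1} := by
    intro x hx y hy a b ha hb hab
    exact ⟨(convex_Ioi (0 : ℝ)) hx.1 hy.1 ha hb hab, (convex_Ioi (0 : ℝ)) hx.2 hy.2 ha hb hab⟩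
  refine ContDiffOn.locallyLipschitzOn hconv ?_
  have e1 : ∀ y ∈ {y : ℝ × ℝ × ℝ × ℝ × ℝ | 0 < y.1 ∧ 0 < y.2.1}, y.1 ≠ 0 := fun y hy => hy.1.ne'
  have e2 : ∀ y ∈ {y : ℝ × ℝ × ℝ × ℝ × ℝ | 0 < y.1 ∧ 0 < y.2.1}, ((r : ℝ) - 1) * y.2.1 ≠ 0 :=
    fun y hy => mul_ne_zero (by linarith) hy.2.ne'
  unfold field
  fun_prop (disch := assumption)

lemma IsSolution.hasDerivWithinAt_tuple {w b q s t : ℝ → ℝ} (h : IsSolution r p w b q s t)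
    {x : ℝ} (hx : 0 ≤ x) :
    HasDerivWithinAt (fun x => (w x, b x, q x, s x, t x))
      (field r (w x, b x, q x, s x, t x)) (Ici 0) x :=
  (h.deriv_w x hx).prodMk ((h.deriv_b x hx).prodMk ((h.deriv_q x hx).prodMk
    ((h.deriv_s x hx).prodMk (h.deriv_t x hx))))

/-- Over `[0, x]` both trajectories stay in one compact set on which the denominators are positive.
There the locally Lipschitz field is Lipschitz, so the usual uniqueness theorem applies. -/
lemma IsSolution.unique (hr : 3 ≤ r) {w b q s t w' b' q' s' t' : ℝ → ℝ}
    (h : IsSolution r p w b q s t) (h' : IsSolution r p w' b' q' s' t') {x : ℝ} (hx : 0 ≤ x) :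
    (w x, b x, q x, s x, t x) = (w' x, b' x, q' x, s' x, t' x) := by
  set F : ℝ → ℝ × ℝ × ℝ × ℝ × ℝ := fun x => (w x, b x, q x, s x, t x) with hF
  set F' : ℝ → ℝ × ℝ × ℝ × ℝ × ℝ := fun x => (w' x, b' x, q' x, s' x, t' x) with hF'
  have hc : ContinuousOn F (Icc 0 x) := fun y hy =>
    (h.hasDerivWithinAt_tuple hy.1).continuousWithinAt.mono fun _ hz => hz.1
  have hc' : ContinuousOn F' (Icc 0 x) := fun y hy =>
    (h'.hasDerivWithinAt_tuple hy.1).continuousWithinAt.mono fun _ hz => hz.1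
  have hK : IsCompact (F '' Icc 0 x ∪ F' '' Icc 0 x) :=
    (isCompact_Icc.image_of_continuousOn hc).union (isCompact_Icc.image_of_continuousOn hc')
  obtain ⟨K, hLip⟩ := ((locallyLipschitzOn_field hr).mono (by
    rintro _ (⟨y, hy, rfl⟩ | ⟨y, hy, rfl⟩)
    · exact ⟨(h.pos y hy.1).1, (h.pos y hy.1).2.1⟩
    · exact ⟨(h'.pos y hy.1).1, (h'.pos y hy.1).2.1⟩)).exists_lipschitzOnWith_of_compact hK
  have := ODE_solution_unique_of_mem_Icc_right (v := fun _ => field r)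
    (s := fun _ => F '' Icc 0 x ∪ F' '' Icc 0 x) (K := K) (f := F) (g := F') (a := 0) (b := x)
    (fun _ _ => hLip) hc
    (fun y hy => (h.hasDerivWithinAt_tuple hy.1).mono (Ici_subset_Ici.2 hy.1))
    (fun y hy => Or.inl ⟨y, Ico_subset_Icc_self hy, rfl⟩) hc'
    (fun y hy => (h'.hasDerivWithinAt_tuple hy.1).mono (Ici_subset_Ici.2 hy.1))
    (fun y hy => Or.inr ⟨y, Ico_subset_Icc_self hy, rfl⟩)
    (by simp only [hF, hF', h.init_w, h.init_b, h.init_q, h.init_s, h.init_t, h'.init_w,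
      h'.init_b, h'.init_q, h'.init_s, h'.init_t])
  exact this (right_mem_Icc.2 hx)

lemma IsXi.unique (hr : 3 ≤ r) {c c' : ℝ} (h : IsXi r p c) (h' : IsXi r p c') : c = c' := by
  obtain ⟨w, b, q, s, t, hs, -, wl, ρ, hw, hρ, rfl⟩ := h
  obtain ⟨w', b', q', s', t', hs', -, wl', ρ', hw', hρ', rfl⟩ := h'
  have key : ∀ x, 0 ≤ x → w x = w' x ∧ b x = b' x ∧ q x = q' x := fun x hx => by
    have := hs.unique hr hs' hx
    simp only [Prod.mk.injEq] at this
    exact ⟨this.1, this.2.1, this.2.2.1⟩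
  have e1 : wl = wl' := by
    refine tendsto_nhds_unique hw (hw'.congr' ?_)
    filter_upwards [eventually_ge_atTop 0] with x hx using ((key x hx).1).symm
  have e2 : ρ = ρ' := by
    refine tendsto_nhds_unique hρ (hρ'.congr' ?_)
    filter_upwards [eventually_ge_atTop 0] with x hx
    rw [(key x hx).1, (key x hx).2.2]
  have e3 : ∫ x in Ioi (0 : ℝ), b x = ∫ x in Ioi (0 : ℝ), b' x :=
    setIntegral_congr_fun measurableSet_Ioi fun x hx => (key x (le_of_lt hx)).2.1
  rw [e1, e2, e3]

lemma isXi_iff (hr : 3 ≤ r) (hp0 : 0 < p) (hp : p < 1) (hφ0 : 0 < φ)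
    (hφ1 : φ < 1 - p) (hφ : profile r p φ = 0) {c : ℝ} : IsXi r p c ↔ c = xiVal r p φ :=
  ⟨fun h => h.unique hr (isXi_xiVal hr hp0 hp hφ0 hφ1 hφ),
    fun h => h ▸ isXi_xiVal hr hp0 hp hφ0 hφ1 hφ⟩

lemma existsUnique_isXi (hr : 3 ≤ r) (hp0 : 0 < p) (hp : p < 1) : ∃! c, IsXi r p c := by
  obtain ⟨φ, hφ0, hφ1, hφ⟩ := exists_profile_eq_zero hr hp0 hp
  exact ⟨_, isXi_xiVal hr hp0 hp hφ0 hφ1 hφ, fun c hc => (isXi_iff hr hp0 hp hφ0 hφ1 hφ).1 hc⟩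

lemma xiVal_le_three (hr : 3 ≤ r) (hp0 : 0 < p) (hp : p < 1) (hφ0 : 0 < φ) (hφ1 : φ < 1 - p) :
    xiVal r p φ ≤ 3 := by
  have h1 := two_le_cast_sub_one hr
  have e1 : (1 - p) ^ r ≤ 1 := pow_le_one₀ (by linarith) (by linarith)
  have e1' : 0 ≤ (1 - p) ^ r := pow_nonneg (by linarith) _
  have e2 : φ ^ r ≤ 1 := pow_le_one₀ hφ0.le (by linarith)
  have e2' : 0 ≤ φ ^ r := pow_nonneg hφ0.le _
  have e3 : (r : ℝ) / (2 * ((r : ℝ) - 1)) ≤ 1 := by rw [div_le_one (by linarith)]; linarith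
  have e3' : 0 ≤ (r : ℝ) / (2 * ((r : ℝ) - 1)) := div_nonneg (by positivity) (by linarith)
  have e4 : (1 - p) ^ 2 - φ ^ 2 ≤ 1 := by nlinarith
  have e4' : 0 ≤ (1 - p) ^ 2 - φ ^ 2 := by nlinarith
  have a1 : p * (1 - p) ^ r ≤ 1 := mul_le_one₀ hp.le e1' e1
  have a2 := mul_le_one₀ e3 e4' e4
  have a3 : (1 - p) * φ ^ r ≤ 1 := mul_le_one₀ (by linarith) e2' e2
  unfold xiVal
  linarith

lemma isLUB_xi (hr : 3 ≤ r) : IsLUB (xiValues r) (xi r) := by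
  refine isLUB_csSup ?_ ⟨3, ?_⟩
  · obtain ⟨c, hc, -⟩ := existsUnique_isXi (p := 1 / 2) hr (by norm_num) (by norm_num)
    exact ⟨c, 1 / 2, by norm_num, hc⟩
  · rintro c ⟨p, ⟨hp0, hp⟩, hc⟩
    obtain ⟨φ, hφ0, hφ1, hφ⟩ := exists_profile_eq_zero hr hp0 hp
    rw [(isXi_iff hr hp0 hp hφ0 hφ1 hφ).1 hc]
    exact xiVal_le_three hr hp0 hp hφ0 hφ1

/-! ### Numerical values -/

lemma profile_three {p f : ℝ} (hp : p < 1) (hf : 0 < f) :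
    profile 3 p f = 1 - f - (2 * (1 - p))⁻¹ * Real.log ((1 - p) / f) := by
  have h2 : 0 < 1 - p := by linarith
  have : (fun x => (rate 3 p x)⁻¹) = fun x => (2 * (1 - p))⁻¹ * x⁻¹ := by
    funext x
    rw [← mul_inv, rate, show 3 - 2 = 1 from rfl, pow_one]
    push_cast
    ring
  rw [profile, this, intervalIntegral.integral_const_mul, integral_inv_of_pos hf h2]

/-- From `r = 4` on, the integrand is a power other than `x⁻¹`, so the sign of the profile at a
rational point is a matter of rational arithmetic; only `r = 3` involves a logarithm. -/
lemma profile_add_four (n : ℕ) {p f : ℝ} (hp : p < 1) (hf : 0 < f) :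
    profile (n + 4) p f = 1 - f -
      ((f ^ (n + 1))⁻¹ - ((1 - p) ^ (n + 1))⁻¹) / ((n + 1) * (n + 3) * (1 - p)) := by
  have h2 : 0 < 1 - p := by linarith
  have : (fun x => (rate (n + 4) p x)⁻¹) =
      fun x => ((n + 3) * (1 - p))⁻¹ * x ^ (-((n : ℤ) + 2)) := by
    funext x
    rw [zpow_neg, ← mul_inv, show (n : ℤ) + 2 = ((n + 2 : ℕ) : ℤ) by push_cast; rfl, zpow_natCast,
      rate, show n + 4 - 2 = n + 2 by omega]
    push_cast
    ring
  have h0 : (0 : ℝ) ∉ Set.uIcc f (1 - p) := fun h => (lt_min hf h2).not_ge h.1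
  rw [profile, this, intervalIntegral.integral_const_mul,
    integral_zpow (Or.inr ⟨by omega, h0⟩),
    show -((n : ℤ) + 2) + 1 = -((n + 1 : ℕ) : ℤ) by push_cast; ring, zpow_neg, zpow_neg,
    zpow_natCast, zpow_natCast]
  push_cast
  have e1 : -((n : ℝ) + 2) + 1 = -(n + 1) := by ring
  rw [e1]
  field_simp
  ring

/-- A bracketing of the zero of the profile gives a bracketing of `ξ(r, p)`. -/
lemma exists_isXi_of_bracket {r : ℕ} (hr : 3 ≤ r) {p lo hi c d : ℝ} (hp0 : 0 < p) (hp : p < 1)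
    (hlo0 : 0 < lo) (hlohi : lo < hi) (hhi1 : hi ≤ 1 - p) (hlo : profile r p lo < 0)
    (hhi : 0 < profile r p hi)
    (h1 : c ≤ p * (1 - p) ^ r + (r : ℝ) / (2 * ((r : ℝ) - 1)) * ((1 - p) ^ 2 - hi ^ 2)
      + (1 - p) * lo ^ r)
    (h2 : p * (1 - p) ^ r + (r : ℝ) / (2 * ((r : ℝ) - 1)) * ((1 - p) ^ 2 - lo ^ 2)
      + (1 - p) * hi ^ r < d) :
    ∃ p₀ ∈ Ioo (0 : ℝ) 1, ∃ c', IsXi r p₀ c' ∧ c ≤ c' ∧ c' < d := by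
  obtain ⟨φ, hφ0, hφ1, hφ⟩ := exists_profile_eq_zero hr hp0 hp
  obtain ⟨hl, hh⟩ := profile_zero_mem_Ioo hr hp0 hp hφ0 hφ1 hφ (by linarith) hlo
    (hlo0.trans hlohi) hhi
  have hr1 := two_le_cast_sub_one hr
  have hc : 0 ≤ (r : ℝ) / (2 * ((r : ℝ) - 1)) := div_nonneg (by positivity) (by linarith)
  have hq : 0 ≤ 1 - p := by linarith
  -- One term of `xiVal` decreases in `φ` and the other increases, which is why `h1` and `h2` mix
  -- the two ends of the bracket.
  refine ⟨p, ⟨hp0, hp⟩, _, isXi_xiVal hr hp0 hp hφ0 hφ1 hφ, h1.trans ?_, lt_of_le_of_lt ?_ h2⟩ <;>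
  · unfold xiVal
    gcongr

/-- For `r = 3` the ratio `(1 - p) / φ` is about `4.91`, whose cube is close to `128 = 2 ^ 7`. Its
logarithm is thus reduced to `Real.log 2` and a rapidly convergent series at a small `x`. -/
lemma log_bounds_of_cube {y : ℝ} (x : ℝ) (hx : y ^ 3 = 128 * (1 - x))
    (hx0 : 0 ≤ x) (hx1 : x ≤ 1 / 10) :
    |3 * Real.log y - (7 * Real.log 2 - (x + x ^ 2 / 2 + x ^ 3 / 3 + x ^ 4 / 4))|
      ≤ x ^ 5 / (9 / 10) := by
  have h := Real.abs_log_sub_add_sum_range_le (x := x) (by rw [abs_of_nonneg hx0]; linarith) 4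
  have e : 3 * Real.log y = 7 * Real.log 2 + Real.log (1 - x) := by
    have h3 : Real.log (y ^ 3) = 3 * Real.log y := by rw [Real.log_pow]; norm_num
    rw [← h3, hx, Real.log_mul (by norm_num) (by linarith), show (128 : ℝ) = 2 ^ 7 by norm_num,
      Real.log_pow]
    norm_num
  rw [abs_of_nonneg hx0] at h
  have h5 : x ^ 5 / (1 - x) ≤ x ^ 5 / (9 / 10) := by gcongr; linarith
  norm_num [Finset.sum_range_succ] at h
  rw [e]
  refine le_trans (le_of_eq ?_) (h.trans h5)
  congr 1
  ring

theorem exists_isXi_table {r : ℕ} (hr : 3 ≤ r) (hr' : r ≤ 10) :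
    ∃ p₀ ∈ Ioo (0 : ℝ) 1, ∃ c, IsXi r p₀ c ∧ tableXi r ≤ c ∧ c < tableXi r + 0.0001 := by
  interval_cases r
  -- In each case the bracket has only to be so narrow that both mixed estimates stay in the window
  -- of width `10⁻⁴`.
  · refine exists_isXi_of_bracket (p := 0.001) (lo := 0.20337) (hi := 0.20341) (by norm_num)
      (by norm_num) (by norm_num) (by norm_num) (by norm_num) (by norm_num) ?_ ?_
      (by norm_num [tableXi]) (by norm_num [tableXi])
    · rw [profile_three (by norm_num) (by norm_num)]
      have h := abs_le.1 (log_bounds_of_cube (y := (1 - 0.001) / 0.20337)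
        (1 - ((1 - 0.001) / 0.20337) ^ 3 / 128) (by ring) (by norm_num) (by norm_num))
      have := Real.log_two_gt_d9
      norm_num at h this ⊢
      linarith
    · rw [profile_three (by norm_num) (by norm_num)]
      have h := abs_le.1 (log_bounds_of_cube (y := (1 - 0.001) / 0.20341)
        (1 - ((1 - 0.001) / 0.20341) ^ 3 / 128) (by ring) (by norm_num) (by norm_num))
      have := Real.log_two_lt_d9
      norm_num at h this ⊢
      linarith
  · refine exists_isXi_of_bracket (p := 0.001) (lo := 0.33349) (hi := 0.33351) (by norm_num)
      (by norm_num) (by norm_num) (by norm_num) (by norm_num) (by norm_num) ?_ ?_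
      (by norm_num [tableXi]) (by norm_num [tableXi]) <;>
    · rw [profile_add_four 0 (by norm_num) (by norm_num)]; norm_num
  · refine exists_isXi_of_bracket (p := 0.001) (lo := 0.42167) (hi := 0.42168) (by norm_num)
      (by norm_num) (by norm_num) (by norm_num) (by norm_num) (by norm_num) ?_ ?_
      (by norm_num [tableXi]) (by norm_num [tableXi]) <;>
    · rw [profile_add_four 1 (by norm_num) (by norm_num)]; norm_num
  · refine exists_isXi_of_bracket (p := 0.001) (lo := 0.48615) (hi := 0.48617) (by norm_num)
      (by norm_num) (by norm_num) (by norm_num) (by norm_num) (by norm_num) ?_ ?_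
      (by norm_num [tableXi]) (by norm_num [tableXi]) <;>
    · rw [profile_add_four 2 (by norm_num) (by norm_num)]; norm_num
  · refine exists_isXi_of_bracket (p := 0.001) (lo := 0.53579) (hi := 0.53581) (by norm_num)
      (by norm_num) (by norm_num) (by norm_num) (by norm_num) (by norm_num) ?_ ?_
      (by norm_num [tableXi]) (by norm_num [tableXi]) <;>
    · rw [profile_add_four 3 (by norm_num) (by norm_num)]; norm_num
  · refine exists_isXi_of_bracket (p := 0.001) (lo := 0.57542) (hi := 0.57544) (by norm_num)
      (by norm_num) (by norm_num) (by norm_num) (by norm_num) (by norm_num) ?_ ?_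
      (by norm_num [tableXi]) (by norm_num [tableXi]) <;>
    · rw [profile_add_four 4 (by norm_num) (by norm_num)]; norm_num
  · refine exists_isXi_of_bracket (p := 0.0007) (lo := 0.60792) (hi := 0.60793) (by norm_num)
      (by norm_num) (by norm_num) (by norm_num) (by norm_num) (by norm_num) ?_ ?_
      (by norm_num [tableXi]) (by norm_num [tableXi]) <;>
    · rw [profile_add_four 5 (by norm_num) (by norm_num)]; norm_num
  · refine exists_isXi_of_bracket (p := 0.001) (lo := 0.63520) (hi := 0.63521) (by norm_num)
      (by norm_num) (by norm_num) (by norm_num) (by norm_num) (by norm_num) ?_ ?_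
      (by norm_num [tableXi]) (by norm_num [tableXi]) <;>
    · rw [profile_add_four 6 (by norm_num) (by norm_num)]; norm_num

/-! ### The discretized system -/

/-- The discretization with step `ε` of the pair (surviving fraction, active fraction). -/
def fracs (r : ℕ) (p ε : ℝ) : ℕ → ℝ × ℝ
  | 0 => (1 - p, p)
  | i + 1 => ((fracs r p ε i).1 - ε * (rate r p (fracs r p ε i).1 * (fracs r p ε i).2),
      (1 - ε) * (fracs r p ε i).2 + ε * (rate r p (fracs r p ε i).1 * (fracs r p ε i).2))

/-- The fraction of branches surviving after `i` steps. -/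
def surv (r : ℕ) (p ε : ℝ) (i : ℕ) : ℝ := (fracs r p ε i).1

/-- The fraction of branches that are explored and have not been activated after `i` steps. -/
def act (r : ℕ) (p ε : ℝ) (i : ℕ) : ℝ := (fracs r p ε i).2

section discrete

variable {r : ℕ} {p ε φ : ℝ}

@[simp] lemma surv_zero : surv r p ε 0 = 1 - p := rfl

@[simp] lemma act_zero : act r p ε 0 = p := rfl

lemma surv_succ (i : ℕ) : surv r p ε (i + 1) =
    surv r p ε i - ε * (rate r p (surv r p ε i) * act r p ε i) := rfl

lemma act_succ (i : ℕ) : act r p ε (i + 1) =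
    (1 - ε) * act r p ε i + (surv r p ε i - surv r p ε (i + 1)) := by
  rw [surv_succ, sub_sub_cancel]; rfl

/-- A step removes at most the proportion `ε (r - 1) < 1` of the surviving fraction, which therefore
stays positive; the sum of the two fractions only loses `ε * act`. -/
lemma fracs_bounds (hr : 3 ≤ r) (hp0 : 0 < p) (hp : p < 1) (hε : 0 < ε)
    (hε1 : ε * ((r : ℝ) - 1) < 1) (i : ℕ) :
    0 < surv r p ε i ∧ 0 ≤ act r p ε i ∧ surv r p ε i + act r p ε i ≤ 1 := by
  have h1 := two_le_cast_sub_one hr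
  induction i with
  | zero => simp [hp, hp0.le]
  | succ i ih =>
    obtain ⟨hf, hh, hs⟩ := ih
    have hf1 : surv r p ε i ≤ 1 := by linarith
    have hrate := rate_le_mul hr hp0.le hf.le hf1
    have hrate0 := rate_pos hr hp hf
    have hε2 : ε < 1 := by nlinarith
    have hprod : 0 ≤ rate r p (surv r p ε i) * act r p ε i := mul_nonneg hrate0.le hh
    rw [act_succ, surv_succ]
    refine ⟨?_, ?_, by nlinarith⟩
    · have : rate r p (surv r p ε i) * act r p ε i ≤ ((r : ℝ) - 1) * surv r p ε i * 1 :=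
        mul_le_mul hrate (by linarith) hh (mul_nonneg (by linarith) hf.le)
      nlinarith
    · have := mul_nonneg hε.le hprod
      have := mul_nonneg (sub_nonneg.2 hε2.le) hh
      linarith

lemma surv_sub_nonneg (hr : 3 ≤ r) (hp0 : 0 < p) (hp : p < 1) (hε : 0 < ε)
    (hε1 : ε * ((r : ℝ) - 1) < 1) (i : ℕ) : 0 ≤ surv r p ε i - surv r p ε (i + 1) := by
  obtain ⟨hf, hh, -⟩ := fracs_bounds hr hp0 hp hε hε1 i
  rw [surv_succ, sub_sub_cancel]
  exact mul_nonneg hε.le (mul_nonneg (rate_pos hr hp hf).le hh)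

lemma surv_antitone (hr : 3 ≤ r) (hp0 : 0 < p) (hp : p < 1) (hε : 0 < ε)
    (hε1 : ε * ((r : ℝ) - 1) < 1) : Antitone (surv r p ε) :=
  antitone_nat_of_succ_le fun i => by linarith [surv_sub_nonneg hr hp0 hp hε hε1 i]

lemma surv_sub_le (hr : 3 ≤ r) (hp0 : 0 < p) (hp : p < 1) (hε : 0 < ε)
    (hε1 : ε * ((r : ℝ) - 1) < 1) (i : ℕ) :
    surv r p ε i - surv r p ε (i + 1) ≤ ε * ((r : ℝ) - 1) := by
  have h1 := two_le_cast_sub_one hr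
  obtain ⟨hf, hh, hs⟩ := fracs_bounds hr hp0 hp hε hε1 i
  have hrate := rate_le_mul hr hp0.le hf.le (by linarith)
  rw [surv_succ, sub_sub_cancel]
  refine mul_le_mul_of_nonneg_left ?_ hε.le
  calc rate r p (surv r p ε i) * act r p ε i ≤ ((r : ℝ) - 1) * 1 :=
        mul_le_mul (hrate.trans (by nlinarith)) (by linarith) hh (by linarith)
    _ = _ := mul_one _

lemma profile_sub_bounds (hr : 3 ≤ r) (hp : p < 1) {f g : ℝ} (hg : 0 < g) (hgf : g ≤ f) :
    (-1 + (rate r p f)⁻¹) * (f - g) ≤ profile r p f - profile r p g ∧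
      profile r p f - profile r p g ≤ (-1 + (rate r p g)⁻¹) * (f - g) := by
  have hc : ContinuousOn (profile r p) (Icc g f) :=
    (continuousOn_profile hr hp).mono fun x hx => hg.trans_le hx.1
  have hd : DifferentiableOn ℝ (profile r p) (interior (Icc g f)) := fun x hx => by
    rw [interior_Icc] at hx
    exact (hasDerivAt_profile hr hp (hg.trans hx.1)).differentiableAt.differentiableWithinAt
  constructor
  · refine (convex_Icc g f).mul_sub_le_image_sub_of_le_deriv hc hd (fun x hx => ?_)
      g (left_mem_Icc.2 hgf) f (right_mem_Icc.2 hgf) hgf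
    rw [interior_Icc] at hx
    have hx0 := hg.trans hx.1
    rw [(hasDerivAt_profile hr hp hx0).deriv]
    have := inv_anti₀ (rate_pos hr hp hx0) (rate_le_rate hr hp hx0.le hx.2.le)
    linarith
  · refine (convex_Icc g f).image_sub_le_mul_sub_of_deriv_le hc hd (fun x hx => ?_)
      g (left_mem_Icc.2 hgf) f (right_mem_Icc.2 hgf) hgf
    rw [interior_Icc] at hx
    rw [(hasDerivAt_profile hr hp (hg.trans hx.1)).deriv]
    have := inv_anti₀ (rate_pos hr hp hg) (rate_le_rate hr hp hg.le hx.1.le)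
    linarith

/-- The discretized pair stays close to the first integral. -/
lemma act_sub_profile (hr : 3 ≤ r) (hp0 : 0 < p) (hp : p < 1) (hε : 0 < ε)
    (hε1 : ε * ((r : ℝ) - 1) < 1) (i : ℕ) :
    profile r p (surv r p ε i) ≤ act r p ε i ∧
      act r p ε i ≤ profile r p (surv r p ε i) +
        ε * ((r : ℝ) - 1) * ((rate r p (surv r p ε i))⁻¹ - (rate r p (1 - p))⁻¹) := by
  induction i with
  | zero => simp [profile_init]
  | succ i ih =>
    obtain ⟨hf, hh, hs⟩ := fracs_bounds hr hp0 hp hε hε1 i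
    obtain ⟨hg, -, -⟩ := fracs_bounds hr hp0 hp hε hε1 (i + 1)
    have hd0 := surv_sub_nonneg hr hp0 hp hε hε1 i
    have hd1 := surv_sub_le hr hp0 hp hε hε1 i
    obtain ⟨b1, b2⟩ := profile_sub_bounds hr hp hg (by linarith : surv r p ε (i + 1) ≤ surv r p ε i)
    have hrf := rate_pos hr hp hf
    have hrg := rate_pos hr hp hg
    have hinv := inv_anti₀ hrg (rate_le_rate hr hp hg.le (by linarith : _ ≤ surv r p ε i))
    -- In the variable `surv`, the recursion for `act` is an Euler step for the profile with the
    -- slope taken at the upper end. By concavity its error has a sign, and it is at most the step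
    -- length times the increase of `1 / rate`, which telescopes.
    have e : ε * act r p ε i =
        (rate r p (surv r p ε i))⁻¹ * (surv r p ε i - surv r p ε (i + 1)) := by
      rw [surv_succ, sub_sub_cancel]; field_simp
    have hact : act r p ε (i + 1) = act r p ε i -
        (rate r p (surv r p ε i))⁻¹ * (surv r p ε i - surv r p ε (i + 1)) +
        (surv r p ε i - surv r p ε (i + 1)) := by
      rw [act_succ, ← e]; ring
    rw [hact]
    constructor
    · linarith [ih.1]
    · have := mul_le_mul_of_nonneg_right hd1 (sub_nonneg.2 hinv)
      linarith [ih.2]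

/-- For a small step size the surviving fraction does not fall below the zero of the profile by
more than `η`. -/
lemma surv_gt (hr : 3 ≤ r) (hp0 : 0 < p) (hp : p < 1) (hφ0 : 0 < φ)
    (hφ1 : φ < 1 - p) (hφ : profile r p φ = 0) {η : ℝ} (hη : 0 < η) (hηφ : 2 * η < φ)
    (hε : 0 < ε) (hε1 : ε * ((r : ℝ) - 1) < 1) (hεη : ε * ((r : ℝ) - 1) ≤ η)
    (hε2 : ε * ((r : ℝ) - 1) * (rate r p (φ - 2 * η))⁻¹ < -profile r p (φ - η)) (i : ℕ) :
    φ - η < surv r p ε i := by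
  induction i with
  | zero => simp; linarith
  | succ i ih =>
    -- At a first crossing the value is still at least `φ - 2 * η`, as a step has length at most
    -- `η`. There the error term is too small to compensate the negative profile, so `act` would be
    -- negative.
    by_contra! hle
    have hd1 := surv_sub_le hr hp0 hp hε hε1 i
    obtain ⟨hg, hh, -⟩ := fracs_bounds hr hp0 hp hε hε1 (i + 1)
    have h1 := (act_sub_profile hr hp0 hp hε hε1 (i + 1)).2
    have h2 : profile r p (surv r p ε (i + 1)) ≤ profile r p (φ - η) :=
      (profile_strictMonoOn hr hp0 hp hφ0 hφ1 hφ).monotoneOn ⟨hg, by linarith⟩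
        ⟨by linarith, by linarith⟩ hle
    have h3 : (rate r p (surv r p ε (i + 1)))⁻¹ ≤ (rate r p (φ - 2 * η))⁻¹ :=
      inv_anti₀ (rate_pos hr hp (by linarith)) (rate_le_rate hr hp (by linarith) (by linarith))
    have h4 : 0 < (rate r p (1 - p))⁻¹ := inv_pos.2 (rate_pos hr hp (by linarith))
    have h5 : 0 ≤ ε * ((r : ℝ) - 1) := mul_nonneg hε.le (by linarith [two_le_cast_sub_one hr])
    have h6 := mul_le_mul_of_nonneg_left
      (show (rate r p (surv r p ε (i + 1)))⁻¹ - (rate r p (1 - p))⁻¹ ≤ (rate r p (φ - 2 * η))⁻¹ by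
        linarith) h5
    linarith

/-- The surviving fraction eventually falls below the zero of the profile plus `η`. -/
lemma exists_surv_lt (hr : 3 ≤ r) (hp0 : 0 < p) (hp : p < 1) (hφ0 : 0 < φ)
    (hφ1 : φ < 1 - p) (hφ : profile r p φ = 0) {η : ℝ} (hη : 0 < η)
    (hε : 0 < ε) (hε1 : ε * ((r : ℝ) - 1) < 1) : ∃ N, surv r p ε N < φ + η := by
  by_contra! hge
  have hle : ∀ i, surv r p ε i ≤ 1 - p := fun i =>
    surv_antitone hr hp0 hp hε hε1 (Nat.zero_le i)
  obtain ⟨y, hy, hmin⟩ := (isCompact_Icc (a := φ + η) (b := 1 - p)).exists_isMinOn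
    ⟨surv r p ε 0, hge 0, hle 0⟩
    ((continuousOn_profile hr hp).mono fun x hx => (by linarith : (0 : ℝ) < φ + η).trans_le hx.1)
  have hy0 : 0 < profile r p y :=
    profile_pos hr hp0 hp hφ0 hφ1 hφ (by linarith [hy.1]) hy.2
  -- As long as `surv` stays above `φ + η`, the profile is bounded below by its positive minimum, so
  -- each step descends by at least `κ`.
  set κ := ε * (rate r p φ * profile r p y) with hκ
  have hκ0 : 0 < κ := mul_pos hε (mul_pos (rate_pos hr hp hφ0) hy0)
  have hstep : ∀ i, surv r p ε (i + 1) ≤ surv r p ε i - κ := fun i => by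
    rw [surv_succ]
    have h1 : profile r p y ≤ act r p ε i :=
      (hmin ⟨hge i, hle i⟩ : profile r p y ≤ profile r p (surv r p ε i)).trans
        (act_sub_profile hr hp0 hp hε hε1 i).1
    have h2 : rate r p φ ≤ rate r p (surv r p ε i) :=
      rate_le_rate hr hp hφ0.le (by linarith [hge i])
    have h3 := mul_le_mul h2 h1 hy0.le (rate_pos hr hp (by linarith [hge i])).le
    have := mul_le_mul_of_nonneg_left h3 hε.le
    linarith
  have hlin : ∀ i : ℕ, surv r p ε i ≤ 1 - p - i * κ := fun i => by
    induction i with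
    | zero => simp
    | succ i ih => push_cast; linarith [hstep i]
  obtain ⟨i, hi⟩ := exists_nat_gt (1 / κ)
  rw [div_lt_iff₀ hκ0] at hi
  linarith [hlin i, hge i]

lemma exists_step_surv_near (hr : 3 ≤ r) (hp0 : 0 < p) (hp : p < 1) (hφ0 : 0 < φ)
    (hφ1 : φ < 1 - p) (hφ : profile r p φ = 0) {η : ℝ} (hη : 0 < η) :
    ∃ ε, 0 < ε ∧ ε < η ∧ ε * ((r : ℝ) - 1) < 1 ∧ ∃ N, |surv r p ε N - φ| < η := by
  wlog hηφ : 2 * η < φ generalizing η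
  · obtain ⟨ε, h0, h1, h2, N, hN⟩ := this (η := min η (φ / 3)) (by positivity)
      (by linarith [min_le_right η (φ / 3)])
    exact ⟨ε, h0, h1.trans_le (min_le_left _ _), h2, N, hN.trans_le (min_le_left _ _)⟩
  have hr1 := two_le_cast_sub_one hr
  have hneg : 0 < -profile r p (φ - η) := by
    have := (profile_strictMonoOn hr hp0 hp hφ0 hφ1 hφ) (a := φ - η) ⟨by linarith, by linarith⟩
      ⟨hφ0, le_rfl⟩ (by linarith)
    linarith
  have hrate := rate_pos hr hp (by linarith : 0 < φ - 2 * η)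
  -- `m` is the value of `ε (r - 1)`; the three terms secure the bound by one, the bound by `η`, and
  -- the smallness of the error required in `surv_gt`.
  set m := min (min (1 / 2) (η / 2)) (-profile r p (φ - η) * rate r p (φ - 2 * η) / 2) with hm
  have hm0 : 0 < m := by positivity
  have hm1 : m < 1 := by linarith [(min_le_left _ _ : m ≤ _).trans (min_le_left _ _)]
  have hm2 : m ≤ η / 2 := (min_le_left _ _ : m ≤ _).trans (min_le_right _ _)
  have hm3 : m ≤ -profile r p (φ - η) * rate r p (φ - 2 * η) / 2 := min_le_right _ _
  have e : m / ((r : ℝ) - 1) * ((r : ℝ) - 1) = m := div_mul_cancel₀ _ (by linarith)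
  refine ⟨m / ((r : ℝ) - 1), div_pos hm0 (by linarith), ?_, by rwa [e], ?_⟩
  · rw [div_lt_iff₀ (by linarith)]; nlinarith
  · obtain ⟨N, hN⟩ := exists_surv_lt (ε := m / ((r : ℝ) - 1)) hr hp0 hp hφ0 hφ1 hφ hη
      (div_pos hm0 (by linarith)) (by rwa [e])
    refine ⟨N, abs_lt.2 ⟨?_, by linarith⟩⟩
    have := surv_gt (ε := m / ((r : ℝ) - 1)) hr hp0 hp hφ0 hφ1 hφ hη hηφ (div_pos hm0 (by linarith)) (by rwa [e])
      (by rw [e]; linarith) (by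
        rw [e, ← div_eq_mul_inv, div_lt_iff₀ hrate]
        have := mul_pos hneg hrate
        linarith) N
    linarith

/-- The gain of a step is `(r / (r - 1)) x (x - y)` with `x`, `y` consecutive surviving fractions,
and `x² - y² ≤ 2 x (x - y)`. The sum dominates the integral with no error term. -/
lemma sum_gain_ge (hr : 3 ≤ r) (N : ℕ) :
    (r : ℝ) / (2 * ((r : ℝ) - 1)) * ((1 - p) ^ 2 - surv r p ε N ^ 2) ≤
      ∑ i ∈ Finset.range N,
        ε * ((1 - p) * r * act r p ε i * surv r p ε i ^ (r - 1)) := by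
  have hr1 := two_le_cast_sub_one hr
  induction N with
  | zero => simp
  | succ N ih =>
    rw [Finset.sum_range_succ]
    have e : ε * ((1 - p) * r * act r p ε N * surv r p ε N ^ (r - 1)) =
        (r : ℝ) / (2 * ((r : ℝ) - 1)) *
          (2 * surv r p ε N * (surv r p ε N - surv r p ε (N + 1))) := by
      rw [surv_succ, sub_sub_cancel, rate, show r - 1 = (r - 2) + 1 by omega, pow_succ]
      have : (r : ℝ) - 1 ≠ 0 := by linarith
      field_simp
    have hc : 0 ≤ (r : ℝ) / (2 * ((r : ℝ) - 1)) := div_nonneg (by positivity) (by linarith)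
    have := mul_le_mul_of_nonneg_left
      (show surv r p ε N ^ 2 - surv r p ε (N + 1) ^ 2 ≤
        2 * surv r p ε N * (surv r p ε N - surv r p ε (N + 1)) by
          nlinarith [sq_nonneg (surv r p ε N - surv r p ε (N + 1))]) hc
    rw [e]
    linarith

/-- The expected density of the forest found in `N` steps of size `ε`, up to white components of
depth `k`. -/
def density (r : ℕ) (p ε : ℝ) (N k : ℕ) : ℝ :=
  p * (1 - p) ^ r +
    (1 - ε) ^ r * ∑ i ∈ Finset.range N, ε * ((1 - p) * r * act r p ε i * surv r p ε i ^ (r - 1)) +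
    ((1 - p) * surv r p ε N ^ r - r * rate r p (surv r p ε N) ^ k)

/-- The loss is split in three: continuity in the final surviving fraction, the factor `(1 - ε) ^ r`
(by Bernoulli), and the deep white paths. The depth `k` is fixed before `ε`, through a `ρ` strictly
between `rate φ` and `1`. -/
lemma exists_density_ge (hr : 3 ≤ r) (hp0 : 0 < p) (hp : p < 1) (hφ0 : 0 < φ)
    (hφ1 : φ < 1 - p) (hφ : profile r p φ = 0) {δ : ℝ} (hδ : 0 < δ) :
    ∃ ε, 0 < ε ∧ ε * ((r : ℝ) - 1) < 1 ∧ ∃ N k, xiVal r p φ - δ ≤ density r p ε N k := by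
  have hr1 := two_le_cast_sub_one hr
  have hrpos : (0 : ℝ) < r := by linarith
  have hρ := rate_zero_lt_one hr hp0 hp hφ0 hφ1 hφ
  obtain ⟨ρ, hρ1, hρ2⟩ := exists_between hρ
  have hρ0 : 0 < ρ := (rate_pos hr hp hφ0).trans hρ1
  obtain ⟨k, hk⟩ := exists_pow_lt_of_lt_one (show 0 < δ / (3 * r) by positivity) hρ2
  set F : ℝ → ℝ := fun f => (r : ℝ) / (2 * ((r : ℝ) - 1)) * ((1 - p) ^ 2 - f ^ 2) + (1 - p) * f ^ r
    with hF
  have hFc : Continuous F := by fun_prop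
  have hev : ∀ᶠ f in 𝓝 φ, rate r p f < ρ ∧ F φ - δ / 3 < F f :=
    (continuous_rate.continuousAt.eventually_lt continuousAt_const hρ1).and
      (continuousAt_const.eventually_lt hFc.continuousAt (by linarith))
  obtain ⟨η, hη, hball⟩ := Metric.eventually_nhds_iff.1 hev
  obtain ⟨ε, hε, hεη, hε1, N, hN⟩ := exists_step_surv_near hr hp0 hp hφ0 hφ1 hφ
    (lt_min hη (show 0 < δ / (3 * r) by positivity))
  obtain ⟨hf1, hf2⟩ := hball (y := surv r p ε N)
    (by rw [Real.dist_eq]; exact hN.trans_le (min_le_left _ _))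
  refine ⟨ε, hε, hε1, N, k, ?_⟩
  have hf0 := (fracs_bounds hr hp0 hp hε hε1 N).1
  have hfle : surv r p ε N ≤ 1 - p := surv_antitone hr hp0 hp hε hε1 (Nat.zero_le N)
  have hgain := sum_gain_ge (p := p) (ε := ε) hr N
  have hεlt : ε < 1 := by nlinarith
  have hb : 1 - r * ε ≤ (1 - ε) ^ r := by
    have := one_add_mul_le_pow (show -2 ≤ -ε by linarith) r
    calc 1 - r * ε = 1 + r * -ε := by ring
      _ ≤ (1 + -ε) ^ r := this
      _ = _ := by rw [← sub_eq_add_neg]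
  have hpow : rate r p (surv r p ε N) ^ k ≤ ρ ^ k :=
    pow_le_pow_left₀ (rate_pos hr hp hf0).le hf1.le k
  have hrk : r * rate r p (surv r p ε N) ^ k ≤ δ / 3 := by
    have := mul_le_mul_of_nonneg_left (hpow.trans hk.le) hrpos.le
    refine this.trans (le_of_eq ?_)
    field_simp
  have hA : (r : ℝ) / (2 * ((r : ℝ) - 1)) ≤ 1 := by rw [div_le_one (by linarith)]; linarith
  have hA0 : 0 ≤ (r : ℝ) / (2 * ((r : ℝ) - 1)) := div_nonneg (by positivity) (by linarith)
  have hB0 : 0 ≤ (1 - p) ^ 2 - surv r p ε N ^ 2 := by nlinarith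
  have hB : (1 - p) ^ 2 - surv r p ε N ^ 2 ≤ 1 := by nlinarith
  set G := (r : ℝ) / (2 * ((r : ℝ) - 1)) * ((1 - p) ^ 2 - surv r p ε N ^ 2) with hG
  have hG0 : 0 ≤ G := mul_nonneg hA0 hB0
  have hG1 : G ≤ 1 := mul_le_one₀ hA hB0 hB
  have hrε : r * ε ≤ δ / 3 := by
    have := mul_le_mul_of_nonneg_left (hεη.le.trans (min_le_right _ _)) hrpos.le
    refine this.trans (le_of_eq ?_)
    field_simp
  have hrε0 : 0 ≤ r * ε := by positivity
  have hpow0 : 0 ≤ (1 - ε) ^ r := pow_nonneg (by linarith) _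
  have h1 := mul_le_mul_of_nonneg_left hgain hpow0
  have h2 := mul_le_mul_of_nonneg_right hb hG0
  have h3 := mul_le_mul_of_nonneg_left hG1 hrε0
  have e1 : xiVal r p φ = p * (1 - p) ^ r + F φ := by simp only [xiVal, hF]; ring
  have e2 : F (surv r p ε N) = G + (1 - p) * surv r p ε N ^ r := by simp only [hF, hG]
  rw [e1]
  unfold density
  linarith

end discrete

/-! ### Indicators and expectations on finite product spaces -/

open Classical in
/-- The indicator of a proposition. -/
def ind (P : Prop) : ℝ := if P then 1 else 0

section ind

variable {P Q : Prop}

lemma ind_nonneg : 0 ≤ ind P := by unfold ind; split_ifs <;> norm_num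

lemma ind_of_true (h : P) : ind P = 1 := if_pos h

lemma ind_of_false (h : ¬P) : ind P = 0 := if_neg h

lemma ind_and : ind (P ∧ Q) = ind P * ind Q := by
  by_cases hP : P <;> by_cases hQ : Q <;> simp [ind, hP, hQ]

lemma ind_not : ind (¬P) = 1 - ind P := by by_cases hP : P <;> simp [ind, hP]

lemma ind_or (h : P → ¬Q) : ind (P ∨ Q) = ind P + ind Q := by
  by_cases hP : P
  · simp [ind, hP, h hP]
  · by_cases hQ : Q <;> simp [ind, hP, hQ]

lemma ind_forall {α : Type*} (s : Finset α) (R : α → Prop) :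
    ind (∀ a ∈ s, R a) = ∏ a ∈ s, ind (R a) := by
  classical
  induction s using Finset.induction_on with
  | empty => simp [ind]
  | insert a s ha ih => rw [Finset.prod_insert ha, ← ih, ← ind_and]; simp

lemma ind_exists_le {α : Type*} (s : Finset α) (R : α → Prop) :
    ind (∃ a ∈ s, R a) ≤ ∑ a ∈ s, ind (R a) := by
  by_cases h : ∃ a ∈ s, R a
  · obtain ⟨a, ha, hR⟩ := h
    rw [ind_of_true ⟨a, ha, hR⟩, ← ind_of_true hR]
    exact Finset.single_le_sum (f := fun a => ind (R a)) (fun _ _ => ind_nonneg) ha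
  · rw [ind_of_false h]; exact Finset.sum_nonneg fun _ _ => ind_nonneg

lemma ind_exists {α : Type*} (s : Finset α) (R : α → Prop)
    (hR : ∀ a ∈ s, ∀ b ∈ s, R a → R b → a = b) :
    ind (∃ a ∈ s, R a) = ∑ a ∈ s, ind (R a) := by
  by_cases h : ∃ a ∈ s, R a
  · obtain ⟨a, ha, h⟩ := h
    rw [ind_of_true ⟨a, ha, h⟩, Finset.sum_eq_single a, ind_of_true h]
    · intro b hb hba
      exact ind_of_false fun h' => hba (hR b hb a ha h' h)
    · exact fun h' => absurd ha h'
  · rw [ind_of_false h, Finset.sum_eq_zero]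
    exact fun a ha => ind_of_false fun h' => h ⟨a, ha, h'⟩

end ind

section expect

lemma dependsOn_finset_prod {K A ι : Type*} {s : Finset ι} {F : ι → (K → A) → ℝ} {S : ι → Set K}
    (hF : ∀ i ∈ s, DependsOn (F i) (S i)) :
    DependsOn (fun ω => ∏ i ∈ s, F i ω) (⋃ i ∈ s, S i) := fun _ _ hxy =>
  Finset.prod_congr rfl fun i hi => hF i hi fun k hk => hxy k (Set.mem_biUnion hi hk)

variable {K A : Type*} [Fintype K] [Fintype A] [DecidableEq K] {m : K → A → ℝ}

/-- The expectation of a function on a finite product of finite weighted spaces. -/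
def expect (m : K → A → ℝ) (F : (K → A) → ℝ) : ℝ := ∑ ω, (∏ k, m k (ω k)) * F ω

lemma expect_add (F F' : (K → A) → ℝ) :
    expect m (fun ω => F ω + F' ω) = expect m F + expect m F' := by
  simp [expect, mul_add, Finset.sum_add_distrib]

lemma expect_sub (F F' : (K → A) → ℝ) :
    expect m (fun ω => F ω - F' ω) = expect m F - expect m F' := by
  simp [expect, mul_sub, Finset.sum_sub_distrib]

lemma expect_sum {ι : Type*} (s : Finset ι) (F : ι → (K → A) → ℝ) :
    expect m (fun ω => ∑ i ∈ s, F i ω) = ∑ i ∈ s, expect m (F i) := by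
  simp only [expect, Finset.mul_sum]
  rw [Finset.sum_comm]

lemma expect_mono (hm : ∀ k a, 0 ≤ m k a) {F F' : (K → A) → ℝ} (h : ∀ ω, F ω ≤ F' ω) :
    expect m F ≤ expect m F' :=
  Finset.sum_le_sum fun ω _ =>
    mul_le_mul_of_nonneg_left (h ω) (Finset.prod_nonneg fun k _ => hm k _)

lemma expect_prod_coord (g : K → A → ℝ) :
    expect m (fun ω => ∏ k, g k (ω k)) = ∏ k, ∑ a, m k a * g k a := by
  rw [Finset.prod_univ_sum]
  simp only [expect, ← Finset.prod_mul_distrib, Fintype.piFinset_univ]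

lemma expect_const (h1 : ∀ k, ∑ a, m k a = 1) (c : ℝ) : expect m (fun _ => c) = c := by
  have := expect_prod_coord (m := m) (fun _ _ => 1)
  simp only [Finset.prod_const_one, mul_one, h1] at this
  rw [expect, ← Finset.sum_mul]
  simp only [expect, mul_one] at this
  rw [this, one_mul]

lemma expect_coord (h1 : ∀ k, ∑ a, m k a = 1) (k : K) (g : A → ℝ) :
    expect m (fun ω => g (ω k)) = ∑ a, m k a * g a := by
  have := expect_prod_coord (m := m) (fun j a => if j = k then g a else 1)
  simp only [Finset.prod_ite_eq', Finset.mem_univ, if_true] at this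
  rw [this, Finset.prod_eq_single k]
  · simp
  · intro j _ hj; simp [hj, h1]
  · simp

/-- Functions of disjoint sets of coordinates are uncorrelated. -/
lemma expect_mul (h1 : ∀ k, ∑ a, m k a = 1) {F F' : (K → A) → ℝ} {S T : Set K}
    (hF : DependsOn F S) (hF' : DependsOn F' T) (hST : Disjoint S T) :
    expect m (fun ω => F ω * F' ω) = expect m F * expect m F' := by
  classical
  rcases isEmpty_or_nonempty (K → A) with hE | ⟨⟨ω₀⟩⟩
  · simp [expect]
  let e := Equiv.piEquivPiSubtypeProd (fun k => k ∈ S) (fun _ : K => A)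
  have hprod : ∀ x, (∏ k, m k (e.symm x k)) =
      (∏ k : {k // k ∈ S}, m k (x.1 k)) * ∏ k : {k // k ∉ S}, m k (x.2 k) := by
    intro x
    rw [← Fintype.prod_subtype_mul_prod_subtype (fun k => k ∈ S)]
    congr 1
    · refine Finset.prod_congr rfl fun k _ => ?_
      simp [e, k.2]
    · refine Finset.prod_congr rfl fun k _ => ?_
      simp [e, k.2]
  have key : ∀ H H' : (K → A) → ℝ, DependsOn H S → DependsOn H' Sᶜ →
      expect m (fun ω => H ω * H' ω) =
        (∑ x : {k // k ∈ S} → A, (∏ k : {k // k ∈ S}, m k (x k)) * H (e.symm (x, fun k => ω₀ k))) *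
        (∑ y : {k // k ∉ S} → A, (∏ k : {k // k ∉ S}, m k (y k)) * H' (e.symm (fun k => ω₀ k, y))) := by
    intro H H' hH hH'
    rw [expect, ← e.symm.sum_comp, Finset.sum_mul_sum, Fintype.sum_prod_type]
    refine Finset.sum_congr rfl fun x _ => Finset.sum_congr rfl fun y _ => ?_
    rw [hprod]
    have e1 : H (e.symm (x, y)) = H (e.symm (x, fun k => ω₀ k)) :=
      hH fun k hk => by simp [e, hk]
    have e2 : H' (e.symm (x, y)) = H' (e.symm (fun k => ω₀ k, y)) :=
      hH' fun k hk => by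
        have : k ∉ S := hk
        simp [e, this]
    rw [e1, e2]
    ring
  have hT : DependsOn F' Sᶜ := hF'.mono fun k hk hkS => Set.disjoint_left.1 hST hkS hk
  have hone : ∀ U : Set K, DependsOn (fun _ : K → A => (1 : ℝ)) U := fun U =>
    (dependsOn_const _).mono (Set.empty_subset _)
  -- `key` splits each expectation into a sum over the coordinates in `S` times a sum over the
  -- others; the total masses of the two factors need not be `1` in isolation here, but `k4` says
  -- that their product is.
  have k1 := key F F' hF hT
  have k2 := key F (fun _ => 1) hF (hone _)
  have k3 := key (fun _ => 1) F' (hone _) hT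
  have k4 := key (fun _ => 1) (fun _ => 1) (hone _) (hone _)
  simp only [mul_one, one_mul] at k2 k3 k4
  rw [expect_const h1] at k4
  rw [k1, k2, k3]
  linear_combination
    (∑ x : {k // k ∈ S} → A, (∏ k : {k // k ∈ S}, m k (x k)) * F (e.symm (x, fun k => ω₀ k))) *
    (∑ y : {k // k ∉ S} → A, (∏ k : {k // k ∉ S}, m k (y k)) * F' (e.symm (fun k => ω₀ k, y))) *
      k4

lemma expect_finset_prod (h1 : ∀ k, ∑ a, m k a = 1) {ι : Type*} (s : Finset ι)
    {F : ι → (K → A) → ℝ} {S : ι → Set K} (hF : ∀ i ∈ s, DependsOn (F i) (S i))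
    (hS : ∀ i ∈ s, ∀ j ∈ s, i ≠ j → Disjoint (S i) (S j)) :
    expect m (fun ω => ∏ i ∈ s, F i ω) = ∏ i ∈ s, expect m (F i) := by
  classical
  induction s using Finset.induction_on with
  | empty => simpa using expect_const h1 1
  | insert a s ha ih =>
    simp only [Finset.prod_insert ha]
    rw [← ih (fun i hi => hF i (Finset.mem_insert_of_mem hi))
      fun i hi j hj => hS i (Finset.mem_insert_of_mem hi) j (Finset.mem_insert_of_mem hj)]
    refine expect_mul h1 (hF a (Finset.mem_insert_self _ _))
      (dependsOn_finset_prod fun i hi => hF i (Finset.mem_insert_of_mem hi)) ?_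
    rw [Set.disjoint_iUnion₂_right]
    exact fun i hi => hS a (Finset.mem_insert_self _ _) i (Finset.mem_insert_of_mem hi)
      fun h => ha (h ▸ hi)

lemma exists_expect_le (h0 : ∀ k a, 0 ≤ m k a) (h1 : ∀ k, ∑ a, m k a = 1) (F : (K → A) → ℝ) :
    ∃ ω, expect m F ≤ F ω := by
  by_contra! h
  have hsum : ∑ ω : K → A, (∏ k, m k (ω k)) = 1 := by
    simpa [expect] using expect_const h1 1
  have hlt : expect m F < ∑ ω : K → A, (∏ k, m k (ω k)) * expect m F := by
    obtain ⟨ω, -, hω⟩ := Finset.exists_ne_zero_of_sum_ne_zero (hsum.trans_ne one_ne_zero)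
    refine Finset.sum_lt_sum (fun ω _ => mul_le_mul_of_nonneg_left (h ω).le
      (Finset.prod_nonneg fun k _ => h0 k _)) ⟨ω, Finset.mem_univ _, mul_lt_mul_of_pos_left (h ω)
      ((Finset.prod_nonneg fun k _ => h0 k _).lt_of_ne' hω)⟩
  rw [← Finset.sum_mul, hsum, one_mul] at hlt
  exact hlt.false

end expect

/-! ### Large girth, disjoint branches and a criterion for acyclicity -/

section graph

variable {V : Type*} {G : SimpleGraph V}

/-- In a graph of large girth, short paths between two vertices are unique. -/
lemma isPath_eq_of_length_lt_egirth {g : ℕ} (hg : (g : ℕ∞) ≤ G.egirth) {u v : V}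
    {p q : G.Walk u v} (hp : p.IsPath) (hq : q.IsPath) (hlen : p.length + q.length < g) :
    p = q := by
  classical
  -- The union of the two paths either is acyclic, and then has only one path from `u` to `v`, or
  -- contains a cycle with at most as many edges as both paths together.
  set H : SimpleGraph V := SimpleGraph.fromEdgeSet {e | e ∈ p.edges ∨ e ∈ q.edges} with hH
  have hmem : ∀ e, e ∈ H.edgeSet ↔ e ∈ p.edges ∨ e ∈ q.edges := by
    intro e
    rw [hH, SimpleGraph.edgeSet_fromEdgeSet]
    refine ⟨fun h => h.1, fun h => ⟨h, fun hd => ?_⟩⟩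
    have : e ∈ G.edgeSet := h.elim (fun h => p.edges_subset_edgeSet h)
      fun h => q.edges_subset_edgeSet h
    exact G.not_isDiag_of_mem_edgeSet this hd
  have hp' : ∀ e ∈ p.edges, e ∈ H.edgeSet := fun e he => (hmem e).2 (Or.inl he)
  have hq' : ∀ e ∈ q.edges, e ∈ H.edgeSet := fun e he => (hmem e).2 (Or.inr he)
  by_cases hac : H.IsAcyclic
  · have h := hac.subsingleton_path u v
    have := congrArg Subtype.val (h.elim ⟨p.transfer H hp', hp.transfer hp'⟩
      ⟨q.transfer H hq', hq.transfer hq'⟩)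
    have h2 := congrArg SimpleGraph.Walk.support this
    simp only [SimpleGraph.Walk.support_transfer] at h2
    exact SimpleGraph.Walk.ext_support h2
  · exfalso
    unfold SimpleGraph.IsAcyclic at hac
    push Not at hac
    obtain ⟨a, c, hc⟩ := hac
    have hcG : ∀ e ∈ c.edges, e ∈ G.edgeSet := fun e he =>
      ((hmem e).1 (c.edges_subset_edgeSet he)).elim (fun h => p.edges_subset_edgeSet h)
        fun h => q.edges_subset_edgeSet h
    have h1 := SimpleGraph.le_egirth.1 hg a (c.transfer G hcG) (hc.transfer hcG)
    rw [SimpleGraph.Walk.length_transfer, Nat.cast_le] at h1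
    have h2 : c.edges.length ≤ (p.edges ++ q.edges).length :=
      (hc.edges_nodup.subperm fun e he => by
        rw [List.mem_append]; exact (hmem e).1 (c.edges_subset_edgeSet he)).length_le
    simp only [List.length_append, SimpleGraph.Walk.length_edges] at h2
    omega

variable (G) in
/-- The vertices reached from `v` by non-backtracking walks of length at most `j` that do not
start towards `u`. -/
def branchBall : ℕ → V → V → Set V
  | 0, v, _ => {v}
  | j + 1, v, u => {v} ∪ {x | ∃ w, G.Adj v w ∧ w ≠ u ∧ x ∈ branchBall j w v}

lemma self_mem_branchBall (j : ℕ) (v u : V) : v ∈ branchBall G j v u := by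
  cases j <;> simp [branchBall]

lemma branchBall_subset_succ {j : ℕ} {v u w : V} (hw : G.Adj v w) (hwu : w ≠ u) :
    branchBall G j w v ⊆ branchBall G (j + 1) v u :=
  fun _ hx => Or.inr ⟨w, hw, hwu, hx⟩

lemma branchBall_mono {i j : ℕ} (hij : i ≤ j) (v u : V) :
    branchBall G i v u ⊆ branchBall G j v u := by
  induction i generalizing j v u with
  | zero => rintro x rfl; exact self_mem_branchBall _ _ _
  | succ i ih =>
    obtain ⟨j, rfl⟩ : ∃ k, j = k + 1 := ⟨j - 1, by omega⟩
    rintro x (rfl | ⟨w, hw, hwu, hx⟩)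
    · exact self_mem_branchBall _ _ _
    · exact branchBall_subset_succ hw hwu (ih (by omega) w v hx)

/-- All branches of depth `j` hanging from a common vertex avoid the vertex and are disjoint. -/
structure TreeLike (G : SimpleGraph V) (j : ℕ) : Prop where
  not_mem : ∀ v w, G.Adj v w → v ∉ branchBall G j w v
  disjoint : ∀ v w w', G.Adj v w → G.Adj v w' → w ≠ w' →
    Disjoint (branchBall G j w v) (branchBall G j w' v)

lemma TreeLike.mono {i j : ℕ} (hij : i ≤ j) (h : TreeLike G j) : TreeLike G i :=
  ⟨fun v w hw hv => h.not_mem v w hw (branchBall_mono hij _ _ hv),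
    fun v w w' hw hw' hne => (h.disjoint v w w' hw hw' hne).mono (branchBall_mono hij _ _)
      (branchBall_mono hij _ _)⟩

/-- A non-backtracking walk shorter than the girth cannot return to `v`: its part from `w` to the
return would be a short path other than the edge `wv`. -/
lemma exists_isPath_of_mem_branchBall {g : ℕ} (hg : (g : ℕ∞) ≤ G.egirth) {j : ℕ}
    (hj : j + 2 < g) {v w x : V} (hvw : G.Adj v w) (hx : x ∈ branchBall G j w v) :
    ∃ p : G.Walk w x, (SimpleGraph.Walk.cons hvw p).IsPath ∧ p.length ≤ j := by
  classical
  induction j generalizing v w with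
  | zero =>
    obtain rfl : x = w := hx
    exact ⟨SimpleGraph.Walk.nil, by simp [hvw.ne], by simp⟩
  | succ j ih =>
    rcases hx with rfl | ⟨w', hw', hne, hx⟩
    · exact ⟨SimpleGraph.Walk.nil, by simp [hvw.ne], by simp⟩
    · obtain ⟨p, hp, hlen⟩ := ih (by omega) hw' hx
      refine ⟨SimpleGraph.Walk.cons hw' p, ?_, by simpa using hlen⟩
      rw [SimpleGraph.Walk.cons_isPath_iff]
      refine ⟨hp, fun hv => ?_⟩
      have h1 := hp.takeUntil hv
      have h2 : (SimpleGraph.Walk.cons hvw.symm SimpleGraph.Walk.nil : G.Walk w v).IsPath := by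
        simp [hvw.ne']
      have h3 := (SimpleGraph.Walk.cons hw' p).length_takeUntil_le_length hv
      have := isPath_eq_of_length_lt_egirth hg h1 h2 (by
        simp only [SimpleGraph.Walk.length_cons, SimpleGraph.Walk.length_nil] at h3 ⊢; omega)
      have hsnd := congrArg SimpleGraph.Walk.snd this
      rw [SimpleGraph.Walk.snd_takeUntil hvw.ne] at hsnd
      exact hne (by simpa using hsnd)

/-- A vertex common to two branches would be joined to `v` by two paths with distinct second
vertices and total length at most `2 * j + 2`. -/
lemma treeLike_of_le_egirth {g : ℕ} (hg : (g : ℕ∞) ≤ G.egirth) {j : ℕ} (hj : 2 * j + 2 < g) :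
    TreeLike G j := by
  refine ⟨fun v w hw hv => ?_, fun v w w' hw hw' hne => Set.disjoint_left.2 fun x hx hx' => ?_⟩
  · obtain ⟨p, hp, -⟩ := exists_isPath_of_mem_branchBall hg (by omega) hw hv
    rw [SimpleGraph.Walk.cons_isPath_iff] at hp
    exact hp.2 p.end_mem_support
  · obtain ⟨p, hp, hl⟩ := exists_isPath_of_mem_branchBall hg (by omega) hw hx
    obtain ⟨q, hq, hl'⟩ := exists_isPath_of_mem_branchBall hg (by omega) hw' hx'
    have := isPath_eq_of_length_lt_egirth hg hp hq (by
      simp only [SimpleGraph.Walk.length_cons]; omega)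
    have hsnd := congrArg SimpleGraph.Walk.snd this
    exact hne (by simpa using hsnd)

/-- A graph is acyclic on `S` if no nonempty finite subset of `S` has minimum degree at least
two. -/
lemma isAcyclic_induce_of_no_core {S : Set V}
    (h : ∀ T : Set V, T.Finite → T.Nonempty → T ⊆ S →
      ¬ ∀ v ∈ T, ∃ a ∈ T, ∃ b ∈ T, a ≠ b ∧ G.Adj v a ∧ G.Adj v b) :
    (G.induce S).IsAcyclic := by
  intro u c hc
  refine h (Subtype.val '' {x | x ∈ c.support}) ((List.finite_toSet c.support).image _)
    ⟨u, u, c.start_mem_support, rfl⟩ (by rintro _ ⟨x, -, rfl⟩; exact x.2) ?_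
  rintro _ ⟨x, hx, rfl⟩
  obtain ⟨a, b, hab, hset⟩ := Set.ncard_eq_two.1 (hc.ncard_neighborSet_toSubgraph_eq_two hx)
  have key : ∀ y, y ∈ c.toSubgraph.neighborSet x → y ∈ c.support ∧ G.Adj x y := fun y hy =>
    ⟨(c.mem_verts_toSubgraph).1 (c.toSubgraph.edge_vert hy.symm), c.toSubgraph.adj_sub hy⟩
  have ha := key a (by rw [hset]; simp)
  have hb := key b (by rw [hset]; simp)
  exact ⟨a, ⟨a, ha.1, rfl⟩, b, ⟨b, hb.1, rfl⟩, fun h => hab (Subtype.ext h), ha.2, hb.2⟩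

lemma card_le_tau [Fintype V] {S : Finset V} (hS : (G.induce (S : Set V)).IsAcyclic) :
    S.card ≤ tau G :=
  le_csSup ⟨Fintype.card V, by rintro k ⟨T, -, rfl⟩; exact T.card_le_univ⟩ ⟨S, hS, rfl⟩

end graph

/-! ### The exploration process and its forest -/

/-- The randomness of the exploration process: for each vertex a sequence of activation coins and,
for each of its `r` potential missing neighbours, the time at which this neighbour is explored. -/
structure Seed (V : Type*) (r : ℕ) where
  coin : V → ℕ → Prop
  delay : V → Fin r → ℕ

section process

variable {V : Type*} [Fintype V] [DecidableEq V] (G : SimpleGraph V) [DecidableRel G.Adj] (r : ℕ)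

/-- The neighbours of `v` other than `u`, real or missing. -/
def slots (v u : V) : Finset (V ⊕ Fin r) :=
  ((G.neighborFinset v).erase u).disjSum
    (Finset.univ.filter fun s : Fin r => (s : ℕ) < r - G.degree v)

variable {G r}

lemma inl_mem_slots {v u w : V} : Sum.inl w ∈ slots G r v u ↔ w ≠ u ∧ G.Adj v w := by
  simp [slots]

lemma slots_subset (v u : V) : slots G r v u ⊆ slots G r v v := by
  rintro (w | s) h
  · rw [inl_mem_slots] at h ⊢
    exact ⟨h.2.ne', h.2⟩
  · simpa [slots] using h

lemma card_missing (n : ℕ) : (Finset.univ.filter fun s : Fin r => (s : ℕ) < r - n).card = r - n := by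
  rw [Fin.card_filter_val_lt]
  omega

lemma card_slots_of_adj {v u : V} (hd : G.degree v ≤ r) (h : G.Adj v u) :
    (slots G r v u).card = r - 1 := by
  have hpos : 0 < G.degree v := (G.degree_pos_iff_exists_adj v).2 ⟨u, h⟩
  rw [slots, Finset.card_disjSum, card_missing,
    Finset.card_erase_of_mem (by simpa using h), SimpleGraph.card_neighborFinset_eq_degree]
  omega

lemma card_slots_self {v : V} (hd : G.degree v ≤ r) : (slots G r v v).card = r := by
  rw [slots, Finset.card_disjSum, card_missing, Finset.erase_eq_of_notMem (by simp),
    SimpleGraph.card_neighborFinset_eq_degree]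
  omega

variable (G) (σ : Seed V r)

/-- `v` is explored by time `i` if the neighbour `u` of `v` is ignored: `v` is explored at time `0`
according to its coin, and at time `i + 1` if exactly one of its neighbours is explored by time `i`
and its coin says so. -/
def msg : ℕ → V → V → Prop
  | 0, v, _ => σ.coin v 0
  | i + 1, v, u => msg i v u ∨ (σ.coin v (i + 1) ∧ ∃! a, a ∈ slots G r v u ∧
      Sum.elim (fun w => msg i w v) (fun s => σ.delay v s ≤ i) a)

/-- The neighbour `a` of `v`, real or missing, is explored by time `i`. -/
def arr (i : ℕ) (v : V) (a : V ⊕ Fin r) : Prop :=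
  Sum.elim (fun w => msg G σ i w v) (fun s => σ.delay v s ≤ i) a

/-- The neighbour `a` of `v` is explored by time `i`, and the coin of `v` has not come up since. -/
def live : ℕ → V → V ⊕ Fin r → Prop
  | 0, v, a => arr G σ 0 v a
  | i + 1, v, a => (live i v a ∧ ¬σ.coin v (i + 1)) ∨ (arr G σ (i + 1) v a ∧ ¬arr G σ i v a)

/-- At time `i` the vertex `v` is unexplored and `a` is its only explored neighbour. -/
def blue (i : ℕ) (v u : V) (a : V ⊕ Fin r) : Prop :=
  ¬σ.coin v 0 ∧ live G σ i v a ∧ ∀ b ∈ (slots G r v u).erase a, ¬arr G σ i v b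

/-- At time `i` neither `v` nor any of its neighbours is explored. -/
def white (i : ℕ) (v u : V) : Prop :=
  ¬σ.coin v 0 ∧ ∀ b ∈ slots G r v u, ¬arr G σ i v b

/-- A path of `m` white vertices starts at `v`, not towards `u`. -/
def deep (N : ℕ) : ℕ → V → V → Prop
  | 0, _, _ => True
  | m + 1, v, u => ∃ w ∈ (G.neighborFinset v).erase u, ¬σ.coin v 0 ∧ deep N m w v ∧
      ∀ b ∈ (slots G r v u).erase (Sum.inl w), ¬arr G σ N v b

/-- The vertex `v` is explored at time `i`. -/
def sel : ℕ → V → Prop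
  | 0, v => σ.coin v 0
  | i + 1, v => ∃ a ∈ slots G r v v, σ.coin v (i + 1) ∧ blue G σ i v v a

/-- The vertex `v` is explored at time `i`, and no neighbour has a coin coming up at this time. -/
def kept (i : ℕ) (v : V) : Prop :=
  sel G σ i v ∧ ∀ w ∈ G.neighborFinset v, ¬σ.coin w i

/-- The vertices chosen for the forest. -/
def chosen (N k : ℕ) : Set V :=
  {v | (∃ i ∈ Finset.range (N + 1), kept G σ i v) ∨ (white G σ N v v ∧ ¬deep G σ N k v v)}

variable {G σ}

lemma msg_succ {i : ℕ} {v u : V} : msg G σ (i + 1) v u ↔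
    msg G σ i v u ∨ (σ.coin v (i + 1) ∧ ∃! a, a ∈ slots G r v u ∧ arr G σ i v a) := Iff.rfl

lemma msg_mono {i j : ℕ} (hij : i ≤ j) {v u : V} (h : msg G σ i v u) : msg G σ j v u := by
  induction hij with
  | refl => exact h
  | step _ ih => exact Or.inl ih

lemma arr_mono {i j : ℕ} (hij : i ≤ j) {v : V} {a : V ⊕ Fin r} (h : arr G σ i v a) :
    arr G σ j v a := by
  rcases a with w | s
  · exact msg_mono hij h
  · exact le_trans (show σ.delay v s ≤ i from h) hij

lemma live.arr {i : ℕ} {v : V} {a : V ⊕ Fin r} (h : live G σ i v a) : arr G σ i v a := by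
  cases i with
  | zero => exact h
  | succ i =>
    rcases h with h | h
    · exact arr_mono (Nat.le_succ i) (live.arr h.1)
    · exact h.1

/-- When all neighbours except `a` are silent, the fate of `v` is decided by its own coins and the
moment at which `a` is explored. `live` records just this, without reference to the other branches,
which later gives independence. -/
lemma not_msg_iff {i : ℕ} {v u : V} {a : V ⊕ Fin r} (ha : a ∈ slots G r v u)
    (h : ∀ b ∈ (slots G r v u).erase a, ¬arr G σ i v b) :
    ¬msg G σ i v u ↔ ¬σ.coin v 0 ∧ (live G σ i v a ∨ ¬arr G σ i v a) := by
  induction i with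
  | zero =>
    have : msg G σ 0 v u ↔ σ.coin v 0 := Iff.rfl
    have : live G σ 0 v a ↔ arr G σ 0 v a := Iff.rfl
    tauto
  | succ i ih =>
    have h' : ∀ b ∈ (slots G r v u).erase a, ¬arr G σ i v b := fun b hb hi =>
      h b hb (arr_mono (Nat.le_succ i) hi)
    have hu : (∃! b, b ∈ slots G r v u ∧ arr G σ i v b) ↔ arr G σ i v a := by
      constructor
      · rintro ⟨b, ⟨hb, hab⟩, -⟩
        by_cases hba : b = a
        · exact hba ▸ hab
        · exact absurd hab (h' b (Finset.mem_erase.2 ⟨hba, hb⟩))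
      · intro hab
        refine ⟨a, ⟨ha, hab⟩, fun b hb => ?_⟩
        by_contra hba
        exact h' b (Finset.mem_erase.2 ⟨hba, hb.1⟩) hb.2
    have h1 := arr_mono (G := G) (σ := σ) (v := v) (a := a) (Nat.le_succ i)
    have h2 := live.arr (G := G) (σ := σ) (i := i) (v := v) (a := a)
    have h3 : live G σ (i + 1) v a ↔ (live G σ i v a ∧ ¬σ.coin v (i + 1)) ∨
      (arr G σ (i + 1) v a ∧ ¬arr G σ i v a) := Iff.rfl
    have ih' := ih h'
    rw [msg_succ, hu, h3, not_or, ih']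
    by_cases hi : arr G σ i v a
    · simp only [hi, h1 hi, not_true, and_false, or_false, and_true, and_assoc]
    · simp only [hi, mt h2 hi, not_false_eq_true, and_false, or_true, and_true, false_or, false_and,
        em]

/-- The right-hand side is the condition in the dynamics; the left-hand side is a union of exclusive
events, each a conjunction of conditions on the initial coin, on one branch with the later coins of
`v`, and on the other branches. -/
lemma exists_blue_iff {i : ℕ} {v u : V} : (∃ a ∈ slots G r v u, blue G σ i v u a) ↔
    ¬msg G σ i v u ∧ ∃! a, a ∈ slots G r v u ∧ arr G σ i v a := by
  constructor
  · rintro ⟨a, ha, h0, hl, hb⟩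
    refine ⟨(not_msg_iff ha hb).2 ⟨h0, Or.inl hl⟩, a, ⟨ha, hl.arr⟩, fun b hb' => ?_⟩
    by_contra hba
    exact hb b (Finset.mem_erase.2 ⟨hba, hb'.1⟩) hb'.2
  · rintro ⟨hm, a, ⟨ha, harr⟩, huniq⟩
    have hb : ∀ b ∈ (slots G r v u).erase a, ¬arr G σ i v b := fun b hb h =>
      (Finset.mem_erase.1 hb).1 (huniq b ⟨(Finset.mem_erase.1 hb).2, h⟩)
    have := (not_msg_iff ha hb).1 hm
    exact ⟨a, ha, this.1, this.2.resolve_right (not_not.2 harr), hb⟩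

lemma blue_unique {i : ℕ} {v u : V} {a b : V ⊕ Fin r} (hb' : b ∈ slots G r v u)
    (ha : blue G σ i v u a) (hb : blue G σ i v u b) : a = b := by
  by_contra hne
  exact ha.2.2 b (Finset.mem_erase.2 ⟨fun h => hne h.symm, hb'⟩) hb.2.1.arr

/-- The unexplored event at time `i + 1` in terms of that at time `i`. -/
lemma ind_not_msg_succ (i : ℕ) (v u : V) :
    ind (¬msg G σ (i + 1) v u) = ind (¬msg G σ i v u) -
      ∑ a ∈ slots G r v u, ind (σ.coin v (i + 1) ∧ blue G σ i v u a) := by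
  rw [← ind_exists _ _ fun a _ b hb ha hb' => blue_unique hb ha.2 hb'.2]
  have h := exists_blue_iff (G := G) (σ := σ) (i := i) (v := v) (u := u)
  have h' : (∃ a ∈ slots G r v u, σ.coin v (i + 1) ∧ blue G σ i v u a) ↔
      σ.coin v (i + 1) ∧ ∃ a ∈ slots G r v u, blue G σ i v u a :=
    ⟨fun ⟨a, ha, hc, hb⟩ => ⟨hc, a, ha, hb⟩, fun ⟨hc, a, ha, hb⟩ => ⟨a, ha, hc, hb⟩⟩
  rw [h', h, msg_succ]
  by_cases h1 : msg G σ i v u <;>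
    by_cases h2 : σ.coin v (i + 1) ∧ ∃! a, a ∈ slots G r v u ∧ arr G σ i v a
  · simp [ind, h1]
  · simp [ind, h1]
  · simp [ind, h1, h2]
  · simp [ind, h1, h2]

/-- As long as `v` is unexplored, ignoring it makes no difference to its neighbours. -/
lemma msg_iff_of_not_msg {i : ℕ} {v w : V} (hvw : G.Adj v w) (hv : ¬msg G σ i v v) :
    msg G σ i w v ↔ msg G σ i w w := by
  induction i generalizing v w with
  | zero => exact Iff.rfl
  | succ i ih =>
    have hv' : ¬msg G σ i v v := fun h => hv (Or.inl h)
    have h1 := ih hvw hv'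
    by_cases hw : msg G σ i w w
    · exact iff_of_true (Or.inl (h1.2 hw)) (Or.inl hw)
    -- The induction hypothesis with `v` and `w` exchanged: `v` is not an explored neighbour of `w`,
    -- so omitting it leaves the count unchanged.
    have h2 : ¬arr G σ i w (Sum.inl v) := fun h => hv' ((ih hvw.symm hw).1 h)
    have h3 : ∀ a, (a ∈ slots G r w v ∧ arr G σ i w a) ↔ (a ∈ slots G r w w ∧ arr G σ i w a) := by
      intro a
      refine ⟨fun h => ⟨slots_subset _ _ h.1, h.2⟩, fun h => ⟨?_, h.2⟩⟩
      rcases a with x | s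
      · rw [inl_mem_slots]
        exact ⟨fun hx => h2 (hx ▸ h.2), (inl_mem_slots.1 h.1).2⟩
      · simpa [slots] using h.1
    rw [msg_succ, msg_succ, h1]
    simp only [h3]

lemma white.not_msg {i : ℕ} {v : V} (h : white G σ i v v) : ¬msg G σ i v v := by
  induction i with
  | zero => exact h.1
  | succ i ih =>
    have h' : white G σ i v v := ⟨h.1, fun b hb hi => h.2 b hb (arr_mono (Nat.le_succ i) hi)⟩
    rw [msg_succ]
    rintro (hm | ⟨-, a, ⟨ha, harr⟩, -⟩)
    · exact ih h' hm
    · exact h'.2 a ha harr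

lemma sel.coin {i : ℕ} {v : V} (h : sel G σ i v) : σ.coin v i := by
  cases i with
  | zero => exact h
  | succ i => obtain ⟨a, -, h, -⟩ := h; exact h

lemma sel.msg {i : ℕ} {v : V} (h : sel G σ i v) : msg G σ i v v := by
  cases i with
  | zero => exact h
  | succ i =>
    obtain ⟨a, ha, hc, hb⟩ := h
    exact Or.inr ⟨hc, (exists_blue_iff.1 ⟨a, ha, hb⟩).2⟩

lemma sel.not_msg {i : ℕ} {v : V} (h : sel G σ (i + 1) v) : ¬InducedForest.msg G σ i v v := by
  obtain ⟨a, ha, hc, hb⟩ := h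
  exact (exists_blue_iff.1 ⟨a, ha, hb⟩).1

lemma sel_unique {i j : ℕ} {v : V} (hi : sel G σ i v) (hj : sel G σ j v) : i = j := by
  wlog hij : i ≤ j generalizing i j
  · exact (this hj hi (by omega)).symm
  by_contra hne
  obtain ⟨j, rfl⟩ : ∃ k, j = k + 1 := ⟨j - 1, by omega⟩
  exact hj.not_msg (msg_mono (by omega) hi.msg)

/-- The chosen vertices induce a forest. -/
theorem isAcyclic_chosen (N k : ℕ) : (G.induce (chosen G σ N k)).IsAcyclic := by
  refine isAcyclic_induce_of_no_core fun T hfin hne hT hcore => ?_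
  have hmsg : ∀ v, (∃ i ∈ Finset.range (N + 1), kept G σ i v) → msg G σ N v v := by
    rintro v ⟨i, hi, hk⟩
    exact msg_mono (by rw [Finset.mem_range] at hi; omega) hk.1.msg
  by_cases hw : ∃ v ∈ T, white G σ N v v
  -- Two neighbours inside `T` always leave one that does not lead back to `u`. It is unexplored,
  -- hence white because it is chosen, and the path goes on.
  · have key : ∀ m, ∀ v ∈ T, white G σ N v v → ∀ u, deep G σ N m v u := by
      intro m
      induction m with
      | zero => intros; trivial
      | succ m ih =>
        intro v hv hwv u
        obtain ⟨a, ha, b, hb, hab, hva, hvb⟩ := hcore v hv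
        obtain ⟨w, hwT, hwu, hvw⟩ : ∃ w ∈ T, w ≠ u ∧ G.Adj v w := by
          by_cases h : a = u
          · exact ⟨b, hb, fun h' => hab (h.trans h'.symm), hvb⟩
          · exact ⟨a, ha, h, hva⟩
        have hww : ¬msg G σ N w w := by
          rw [← msg_iff_of_not_msg hvw hwv.not_msg]
          exact hwv.2 (Sum.inl w) (inl_mem_slots.2 ⟨hvw.ne', hvw⟩)
        have hwhite : white G σ N w w :=
          ((hT hwT).resolve_left fun h => hww (hmsg w h)).1
        exact ⟨w, by simp [hwu, hvw], hwv.1, ih w hwT hwhite v, fun b hb =>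
          hwv.2 b (slots_subset _ _ (Finset.mem_of_mem_erase hb))⟩
    obtain ⟨v, hv, hwv⟩ := hw
    exact ((hT hv).resolve_left fun h => hwv.not_msg (hmsg v h)).2 (key k v hv hwv v)
  · push Not at hw
    have hk : ∀ v ∈ T, ∃ i, kept G σ i v := fun v hv =>
      ((hT hv).resolve_right fun h => hw v hv h.1).imp fun i h => h.2
    choose! t ht using hk
    obtain ⟨v, hv, hmax⟩ := Set.exists_max_image T t hfin hne
    obtain ⟨a, ha, b, hb, hab, hva, hvb⟩ := hcore v hv
    -- Maximality of `t v` leaves only ties, and these are excluded because `kept` forbids a coin of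
    -- a neighbour at the same time.
    have hlt : ∀ x ∈ T, G.Adj v x → t x < t v := fun x hx hvx => by
      refine (hmax x hx).lt_of_ne fun h => (ht v hv).2 x (by simpa using hvx) ?_
      exact h ▸ (ht x hx).1.coin
    obtain ⟨i, hi⟩ : ∃ i, t v = i + 1 := ⟨t v - 1, by have := hlt a ha hva; omega⟩
    have hsel := (ht v hv).1
    rw [hi] at hsel
    have harr : ∀ x ∈ T, G.Adj v x → arr G σ i v (Sum.inl x) := fun x hx hvx => by
      have h1 : msg G σ i x x := msg_mono (by have := hlt x hx hvx; omega) (ht x hx).1.msg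
      exact (msg_iff_of_not_msg hvx hsel.not_msg).2 h1
    obtain ⟨y, hy, -, hb'⟩ := hsel
    obtain ⟨-, huniq⟩ := exists_blue_iff.1 ⟨y, hy, hb'⟩
    have := huniq.unique ⟨inl_mem_slots.2 ⟨hva.ne', hva⟩, harr a ha hva⟩
      ⟨inl_mem_slots.2 ⟨hvb.ne', hvb⟩, harr b hb hvb⟩
    exact hab (Sum.inl.inj this)

/-- A lower bound for the indicator of a vertex being chosen by exclusive events. -/
lemma le_ind_mem_chosen (N k : ℕ) (v : V) :
    ∑ i ∈ Finset.range (N + 1), ind (kept G σ i v) +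
      (ind (white G σ N v v) - ind (deep G σ N k v v)) ≤ ind (v ∈ chosen G σ N k) := by
  rw [← ind_exists _ _ fun i _ j _ hi hj => sel_unique hi.1 hj.1]
  have hex : (∃ i ∈ Finset.range (N + 1), kept G σ i v) → ¬white G σ N v v := by
    rintro ⟨i, hi, hk⟩ hw
    exact hw.not_msg (msg_mono (by rw [Finset.mem_range] at hi; omega) hk.1.msg)
  have h1 : ind (v ∈ chosen G σ N k) = ind (∃ i ∈ Finset.range (N + 1), kept G σ i v) +
      ind (white G σ N v v ∧ ¬deep G σ N k v v) := by
    rw [← ind_or fun h h' => hex h h'.1]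
    rfl
  rw [h1]
  by_cases h2 : white G σ N v v <;> by_cases h3 : deep G σ N k v v <;> simp [ind, h2, h3]

end process

/-! ### The sample space and its weights -/

/-- The coordinates of the sample space: coins up to time `N` and delays of missing neighbours. -/
abbrev Coord (V : Type*) (r N : ℕ) := V × (Fin (N + 1) ⊕ Fin r)

/-- The sample space of the exploration process. -/
abbrev Sample (V : Type*) (r N : ℕ) := Coord V r N → Fin (N + 2)

/-- The seed given by a point of the sample space. -/
def seed {V : Type*} {r N : ℕ} (ω : Sample V r N) : Seed V r where
  coin v i := ∃ h : i < N + 1, ω (v, Sum.inl ⟨i, h⟩) = 0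
  delay v s := ω (v, Sum.inr s)

/-- The probability that a missing neighbour is not explored before time `j`. -/
def tail (r : ℕ) (p ε : ℝ) (N j : ℕ) : ℝ :=
  -- The tail vanishes at `N + 2`, so the delay `N + 1` carries all the mass of "not explored by
  -- time `N`".
  if j = 0 then 1 else if j ≤ N + 1 then surv r p ε (j - 1) else 0

/-- The weights of the sample space. -/
def weight {V : Type*} (r : ℕ) (p ε : ℝ) (N : ℕ) (k : Coord V r N) (a : Fin (N + 2)) : ℝ :=
  Sum.elim
    (fun i : Fin (N + 1) =>
      let q := if (i : ℕ) = 0 then p else ε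
      -- Coins share the alphabet of the delays; only the letters `0` (the coin comes up) and `1`
      -- have mass.
      if a = 0 then q else if a = 1 then 1 - q else 0)
    (fun _ => tail r p ε N a - tail r p ε N (a + 1)) k.2

section weights

variable {V : Type*} {r N : ℕ} {p ε : ℝ}

lemma weight_nonneg (hr : 3 ≤ r) (hp0 : 0 < p) (hp : p < 1) (hε : 0 < ε)
    (hε1 : ε * ((r : ℝ) - 1) < 1) (k : Coord V r N) (a : Fin (N + 2)) :
    0 ≤ weight r p ε N k a := by
  have hε2 : ε < 1 := by nlinarith [two_le_cast_sub_one hr]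
  rcases k with ⟨v, i | s⟩
  · simp only [weight, Sum.elim_inl]
    split_ifs <;> linarith
  · simp only [weight, Sum.elim_inr, tail]
    have ha := a.2
    rcases Nat.eq_zero_or_pos (a : ℕ) with h0 | h0
    · simp only [h0]
      norm_num
      linarith
    · have h1 : (a : ℕ) ≠ 0 := by omega
      have h2 : (a : ℕ) ≤ N + 1 := by omega
      simp only [h1, if_false, h2, if_true, Nat.succ_ne_zero, Nat.add_sub_cancel]
      split_ifs with h3
      · rw [sub_nonneg]
        exact surv_antitone hr hp0 hp hε hε1 (by omega)
      · rw [sub_zero]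
        exact (fracs_bounds hr hp0 hp hε hε1 _).1.le

lemma sum_weight_coin (v : V) (i : Fin (N + 1)) (g : Fin (N + 2) → ℝ) :
    ∑ a, weight r p ε N (v, Sum.inl i) a * g a =
      (if (i : ℕ) = 0 then p else ε) * g 0 + (1 - if (i : ℕ) = 0 then p else ε) * g 1 := by
  have h01 : (0 : Fin (N + 2)) ≠ 1 := by simp
  rw [← Finset.sum_subset (Finset.subset_univ {0, 1}), Finset.sum_pair h01]
  · simp [weight]
  · intro a _ ha
    simp only [Finset.mem_insert, Finset.mem_singleton, not_or] at ha
    simp [weight, ha.1, ha.2]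

lemma sum_weight_delay (v : V) (s : Fin r) (g : ℕ → ℝ) :
    ∑ a, weight r p ε N (v, Sum.inr s) a * g a =
      ∑ j ∈ Finset.range (N + 2), (tail r p ε N j - tail r p ε N (j + 1)) * g j := by
  rw [Finset.sum_range]
  simp [weight]

lemma sum_weight (k : Coord V r N) : ∑ a, weight r p ε N k a = 1 := by
  rcases k with ⟨v, i | s⟩
  · have := sum_weight_coin (r := r) (p := p) (ε := ε) v i (fun _ => 1)
    simpa using this
  · have := sum_weight_delay (p := p) (ε := ε) (N := N) v s (fun _ => 1)
    simp only [mul_one] at this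
    rw [this, Finset.sum_range_sub']
    simp [tail]

variable [Fintype V] [DecidableEq V]

/-- The weights of the delays are differences of `tail`, so the sum telescopes; a missing neighbour
thus mimics a real branch. -/
lemma expect_delay {i : ℕ} (hi : i ≤ N) (v : V) (s : Fin r) :
    expect (weight r p ε N) (fun ω : Sample V r N => ind (¬(seed ω).delay v s ≤ i)) =
      surv r p ε i := by
  have h := expect_coord (m := weight r p ε N) (sum_weight (V := V)) (v, Sum.inr s)
    (fun a => ind (¬(a : ℕ) ≤ i))
  have h2 := sum_weight_delay (p := p) (ε := ε) (N := N) v s (fun a => ind (¬a ≤ i))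
  rw [h2] at h
  refine h.trans ?_
  have key : ∀ n, i + 1 ≤ n → ∑ j ∈ Finset.range n,
      (tail r p ε N j - tail r p ε N (j + 1)) * ind (¬j ≤ i) =
        tail r p ε N (i + 1) - tail r p ε N n := by
    intro n hn
    induction n, hn using Nat.le_induction with
    | base =>
      rw [sub_self]
      refine Finset.sum_eq_zero fun j hj => ?_
      rw [ind_of_false (by rw [Finset.mem_range] at hj; omega), mul_zero]
    | succ n hn ih =>
      rw [Finset.sum_range_succ, ih, ind_of_true (by omega)]
      ring
  rw [key _ (by omega)]
  simp [tail, hi]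

lemma expect_coin {i : ℕ} (hi : i ≤ N) (v : V) :
    expect (weight r p ε N) (fun ω : Sample V r N => ind ((seed ω).coin v i)) =
      if i = 0 then p else ε := by
  have h := expect_coord (m := weight r p ε N) (sum_weight (V := V))
    (v, Sum.inl ⟨i, by omega⟩) (fun a => ind (a = 0))
  rw [sum_weight_coin] at h
  have e : (fun ω : Sample V r N => ind ((seed ω).coin v i)) =
      fun ω => ind (ω (v, Sum.inl ⟨i, by omega⟩) = 0) := by
    funext ω
    congr 1
    simp only [seed, eq_iff_iff]
    exact ⟨fun ⟨_, h⟩ => h, fun h => ⟨_, h⟩⟩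
  rw [e, h]
  simp [ind]

lemma expect_not {P : Sample V r N → Prop} :
    expect (weight r p ε N) (fun ω => ind (¬P ω)) =
      1 - expect (weight r p ε N) (fun ω => ind (P ω)) := by
  simp only [ind_not]
  rw [expect_sub, expect_const sum_weight]

end weights

/-! ### Which coordinates the events depend on -/

section dependence

variable {V : Type*} (G : SimpleGraph V) {r N : ℕ}

/-- The coordinates in the ball of radius `j` around `v` away from `u`, with coins up to time
`t`. -/
def region (r N j t : ℕ) (v u : V) : Set (Coord V r N) :=
  {k | k.1 ∈ branchBall G j v u ∧ ∀ l : Fin (N + 1), k.2 = Sum.inl l → (l : ℕ) ≤ t}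

/-- The coordinates of the branch at the neighbour `a` of `v`. -/
def branch (N j t : ℕ) (v : V) (a : V ⊕ Fin r) : Set (Coord V r N) :=
  Sum.elim (fun w => region G r N j t w v) (fun s => {(v, Sum.inr s)}) a

/-- The coins of `v` from time `1` to time `t`. -/
def ownCoins (r N t : ℕ) (v : V) : Set (Coord V r N) :=
  {k | ∃ l : Fin (N + 1), k = (v, Sum.inl l) ∧ 1 ≤ (l : ℕ) ∧ (l : ℕ) ≤ t}

/-- The coins of time `t`. -/
def layer (V : Type*) (r N t : ℕ) : Set (Coord V r N) :=
  {k | ∃ l : Fin (N + 1), k.2 = Sum.inl l ∧ (l : ℕ) = t}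

variable {G}

lemma region_mono {j j' t t' : ℕ} (hj : j ≤ j') (ht : t ≤ t') (v u : V) :
    region G r N j t v u ⊆ region G r N j' t' v u := fun _ hk =>
  ⟨branchBall_mono hj _ _ hk.1, fun l hl => (hk.2 l hl).trans ht⟩

lemma branch_mono {j j' t t' : ℕ} (hj : j ≤ j') (ht : t ≤ t') (v : V) (a : V ⊕ Fin r) :
    branch G N j t v a ⊆ branch G N j' t' v a := by
  rcases a with w | s
  · exact region_mono hj ht w v
  · exact le_rfl

lemma coin_mem_region {j t i : ℕ} (hi : i ≤ t) (h : i < N + 1) (v u : V) :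
    ((v, Sum.inl ⟨i, h⟩) : Coord V r N) ∈ region G r N j t v u :=
  ⟨self_mem_branchBall _ _ _, fun l hl => by
    obtain rfl := Sum.inl.inj hl
    exact hi⟩

lemma branch_time {j t : ℕ} {v : V} {a : V ⊕ Fin r} {k : Coord V r N}
    (hk : k ∈ branch G N j t v a) (l : Fin (N + 1)) (hl : k.2 = Sum.inl l) : (l : ℕ) ≤ t := by
  rcases a with w | s
  · exact hk.2 l hl
  · obtain rfl : k = (v, Sum.inr s) := hk
    simp at hl

lemma dependsOn_coin (v : V) (i : ℕ) :
    DependsOn (fun ω : Sample V r N => (seed ω).coin v i)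
      {k | k.1 = v ∧ ∃ l : Fin (N + 1), k.2 = Sum.inl l ∧ (l : ℕ) = i} := by
  intro x y hxy
  simp only [seed, eq_iff_iff]
  refine exists_congr fun h => ?_
  rw [hxy _ ⟨rfl, ⟨i, h⟩, rfl, rfl⟩]

lemma dependsOn_coin' {v : V} {i : ℕ} {S : Set (Coord V r N)}
    (hS : ∀ h : i < N + 1, (v, Sum.inl ⟨i, h⟩) ∈ S) :
    DependsOn (fun ω : Sample V r N => (seed ω).coin v i) S := by
  refine (dependsOn_coin v i).mono ?_
  rintro ⟨_, _⟩ ⟨rfl, l, rfl, rfl⟩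
  exact hS l.2

lemma dependsOn_ind {S : Set (Coord V r N)} {P : Sample V r N → Prop} (h : DependsOn P S) :
    DependsOn (fun ω => ind (P ω)) S := fun _ _ hxy =>
  congrArg ind (h hxy)

/-- This makes the coins of time `t + 1` independent of everything determined by time `t`. -/
lemma disjoint_layer_of_time {S : Set (Coord V r N)} {t : ℕ}
    (hS : ∀ k ∈ S, ∀ l : Fin (N + 1), k.2 = Sum.inl l → (l : ℕ) ≤ t) :
    Disjoint (layer V r N (t + 1)) S := by
  rw [Set.disjoint_left]
  rintro k ⟨l, hl, ht⟩ hk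
  have := hS k hk l hl
  omega

lemma dependsOn_coin_layer (v : V) (i : ℕ) :
    DependsOn (fun ω : Sample V r N => (seed ω).coin v i) (layer V r N i) :=
  dependsOn_coin' fun h => ⟨⟨i, h⟩, rfl, rfl⟩

lemma ownCoins_union_branch_time {i : ℕ} {v : V} {a : V ⊕ Fin r} :
    ∀ k ∈ branch G N i i v a ∪ ownCoins r N i v,
      ∀ l : Fin (N + 1), k.2 = Sum.inl l → (l : ℕ) ≤ i := by
  rintro k (hk | ⟨l', rfl, -, h2⟩) l hl
  · exact branch_time hk l hl
  · obtain rfl := Sum.inl.inj hl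
    exact h2

variable [Fintype V] [DecidableEq V] [DecidableRel G.Adj]

lemma branch_subset_region {j t : ℕ} {v u : V} {a : V ⊕ Fin r} (ha : a ∈ slots G r v u) :
    branch G N j t v a ⊆ region G r N (j + 1) t v u := by
  rcases a with w | s
  · rw [inl_mem_slots] at ha
    exact fun k hk => ⟨branchBall_subset_succ ha.2 ha.1 hk.1, hk.2⟩
  · rintro k rfl
    exact ⟨self_mem_branchBall _ _ _, fun l hl => by simp at hl⟩

lemma coin_notMem_branch {j t : ℕ} (hT : TreeLike G j) {v : V} {a : V ⊕ Fin r}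
    (ha : a ∈ slots G r v v) (l : Fin (N + 1)) :
    ((v, Sum.inl l) : Coord V r N) ∉ branch G N j t v a := by
  rcases a with w | s
  · rw [inl_mem_slots] at ha
    exact fun h => hT.not_mem v w ha.2 h.1
  · intro h
    have := congrArg Prod.snd (show ((v, Sum.inl l) : Coord V r N) = (v, Sum.inr s) from h)
    simp at this

lemma branch_disjoint {j t : ℕ} (hT : TreeLike G j) {v : V} {a b : V ⊕ Fin r}
    (ha : a ∈ slots G r v v) (hb : b ∈ slots G r v v) (hab : a ≠ b) :
    Disjoint (branch G N j t v a) (branch G N j t v b) := by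
  rw [Set.disjoint_left]
  rcases a with w | s <;> rcases b with w' | s'
  · rw [inl_mem_slots] at ha hb
    intro k hk hk'
    exact Set.disjoint_left.1 (hT.disjoint v w w' ha.2 hb.2 fun h => hab (h ▸ rfl)) hk.1 hk'.1
  · rw [inl_mem_slots] at ha
    rintro k hk rfl
    exact hT.not_mem v w ha.2 hk.1
  · rw [inl_mem_slots] at hb
    rintro k rfl hk
    exact hT.not_mem v w' hb.2 hk.1
  · rintro k rfl hk
    have := congrArg Prod.snd (show ((v, Sum.inr s) : Coord V r N) = (v, Sum.inr s') from hk)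
    exact hab (congrArg Sum.inr (Sum.inr.inj this))

/-- Information travels one edge per unit of time, so the radius equals the time. -/
lemma dependsOn_msg (i : ℕ) (v u : V) :
    DependsOn (fun ω : Sample V r N => msg G (seed ω) i v u) (region G r N i i v u) := by
  induction i generalizing v u with
  | zero => exact dependsOn_coin' fun h => coin_mem_region le_rfl h _ _
  | succ i ih =>
    intro x y hxy
    have h1 : msg G (seed x) i v u = msg G (seed y) i v u :=
      ih v u fun k hk => hxy k (region_mono (Nat.le_succ i) (Nat.le_succ i) _ _ hk)
    have h2 : (seed x).coin v (i + 1) = (seed y).coin v (i + 1) :=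
      dependsOn_coin' (fun h => coin_mem_region le_rfl h _ _) hxy
    have h3 : ∀ a, (a ∈ slots G r v u ∧ arr G (seed x) i v a) =
        (a ∈ slots G r v u ∧ arr G (seed y) i v a) := by
      intro a
      by_cases ha : a ∈ slots G r v u
      · have hsub := branch_subset_region (N := N) (j := i) (t := i) ha
        have : arr G (seed x) i v a = arr G (seed y) i v a := by
          rcases a with w | s
          · exact ih w v fun k hk => hxy k (region_mono le_rfl (Nat.le_succ i) _ _ (hsub hk))
          · have := hxy (v, Sum.inr s) (region_mono le_rfl (Nat.le_succ i) _ _ (hsub rfl))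
            simp only [arr, Sum.elim_inr, seed, this]
        rw [this]
      · simp [ha]
    simp only [msg_succ, h1, h2, h3]

lemma dependsOn_arr (i : ℕ) (v : V) (a : V ⊕ Fin r) :
    DependsOn (fun ω : Sample V r N => arr G (seed ω) i v a) (branch G N i i v a) := by
  rcases a with w | s
  · exact dependsOn_msg i w v
  · intro x y hxy
    have := hxy (v, Sum.inr s) rfl
    simp only [arr, Sum.elim_inr, seed, this]

/-- The initial coin of `v` is left out on purpose: `ownCoins` starts at time `1`, so that this coin
can be factored off in `expect_core`. -/
lemma dependsOn_live (i : ℕ) (v : V) (a : V ⊕ Fin r) :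
    DependsOn (fun ω : Sample V r N => live G (seed ω) i v a)
      (branch G N i i v a ∪ ownCoins r N i v) := by
  induction i with
  | zero => exact (dependsOn_arr 0 v a).mono Set.subset_union_left
  | succ i ih =>
    intro x y hxy
    have h1 : live G (seed x) i v a = live G (seed y) i v a := ih fun k hk => hxy k <| by
      rcases hk with hk | ⟨l, rfl, h1, h2⟩
      · exact Or.inl (branch_mono (Nat.le_succ i) (Nat.le_succ i) _ _ hk)
      · exact Or.inr ⟨l, rfl, h1, by omega⟩
    have h2 : (seed x).coin v (i + 1) = (seed y).coin v (i + 1) :=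
      dependsOn_coin' (fun h => Or.inr ⟨_, rfl, by simp, le_rfl⟩) hxy
    have h3 : arr G (seed x) i v a = arr G (seed y) i v a :=
      dependsOn_arr i v a fun k hk =>
        hxy k (Or.inl (branch_mono (Nat.le_succ i) (Nat.le_succ i) _ _ hk))
    have h4 : arr G (seed x) (i + 1) v a = arr G (seed y) (i + 1) v a :=
      dependsOn_arr (i + 1) v a fun k hk => hxy k (Or.inl hk)
    simp only [live, h1, h2, h3, h4]

lemma dependsOn_deep (m : ℕ) (v u : V) :
    DependsOn (fun ω : Sample V r N => deep G (seed ω) N m v u)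
      (region G r N (N + m) N v u) := by
  induction m generalizing v u with
  | zero => exact (dependsOn_const True).mono (Set.empty_subset _)
  | succ m ih =>
    intro x y hxy
    have h1 : (seed x).coin v 0 = (seed y).coin v 0 :=
      dependsOn_coin' (fun h => coin_mem_region (Nat.zero_le _) h _ _) hxy
    have h2 : ∀ a ∈ slots G r v u, arr G (seed x) N v a = arr G (seed y) N v a := fun a ha =>
      dependsOn_arr N v a fun k hk => hxy k
        (region_mono (by omega) le_rfl _ _ (branch_subset_region ha hk))
    simp only [deep, eq_iff_iff]
    refine exists_congr fun w => and_congr_right fun hw => ?_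
    have hw' : Sum.inl w ∈ slots G r v u := inl_mem_slots.2 (by simpa using hw)
    have h3 : deep G (seed x) N m w v = deep G (seed y) N m w v := ih w v fun k hk => hxy k
      (branch_subset_region (j := N + m) hw' hk)
    rw [h1, h3]
    refine and_congr_right fun _ => and_congr_right fun _ => forall₂_congr fun b hb => ?_
    rw [h2 b (Finset.mem_of_mem_erase hb)]

end dependence

/-! ### The law of the process and the expected density -/

section law

variable {V : Type*} [Fintype V] [DecidableEq V] {G : SimpleGraph V} [DecidableRel G.Adj]
  {r N : ℕ} {p ε : ℝ}

variable (G r N p ε) in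
/-- At time `i` every branch survives with the probability given by the discretized system. -/
def SurvLaw (i : ℕ) : Prop :=
  ∀ v u, G.Adj v u →
    expect (weight r p ε N) (fun ω : Sample V r N => ind (¬msg G (seed ω) i v u)) = surv r p ε i

lemma SurvLaw.expect_arr {i : ℕ} (h : SurvLaw G r N p ε i) (hi : i ≤ N) {v : V} {a : V ⊕ Fin r}
    (ha : a ∈ slots G r v v) :
    expect (weight r p ε N) (fun ω : Sample V r N => ind (¬arr G (seed ω) i v a)) =
      surv r p ε i := by
  rcases a with w | s
  · exact h w v (inl_mem_slots.1 ha).2.symm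
  · exact expect_delay hi v s

/-- A live branch stays live with probability `1 - ε`, by a fresh coin, and newly explored branches
contribute the drop of the survival probability. This is the recursion of `act`. -/
lemma expect_live {i : ℕ} (hi : i ≤ N) (h : ∀ j ≤ i, SurvLaw G r N p ε j) {v : V}
    {a : V ⊕ Fin r} (ha : a ∈ slots G r v v) :
    expect (weight r p ε N) (fun ω : Sample V r N => ind (live G (seed ω) i v a)) =
      act r p ε i := by
  induction i with
  | zero =>
    have h1 := (h 0 le_rfl).expect_arr (Nat.zero_le N) ha
    rw [expect_not, surv_zero] at h1
    have : expect (weight r p ε N) (fun ω : Sample V r N => ind (arr G (seed ω) 0 v a)) = p := by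
      linarith
    exact this
  | succ i ih =>
    have e : ∀ ω : Sample V r N, ind (live G (seed ω) (i + 1) v a) =
        ind (¬(seed ω).coin v (i + 1)) * ind (live G (seed ω) i v a) +
          (ind (¬arr G (seed ω) i v a) - ind (¬arr G (seed ω) (i + 1) v a)) := by
      intro ω
      have h1 : ind (live G (seed ω) (i + 1) v a) =
          ind (live G (seed ω) i v a ∧ ¬(seed ω).coin v (i + 1)) +
            ind (arr G (seed ω) (i + 1) v a ∧ ¬arr G (seed ω) i v a) := by
        rw [← ind_or fun h h' => h'.2 h.1.arr]
        rfl
      rw [h1, ind_and, mul_comm]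
      congr 1
      by_cases h2 : arr G (seed ω) i v a
      · simp [ind, h2, arr_mono (Nat.le_succ i) h2]
      · by_cases h3 : arr G (seed ω) (i + 1) v a <;> simp [ind, h2, h3]
    simp only [e]
    rw [expect_add, expect_sub, (h i (by omega)).expect_arr (by omega) ha,
      (h (i + 1) le_rfl).expect_arr hi ha,
      expect_mul sum_weight (dependsOn_ind (P := fun ω => ¬(seed ω).coin v (i + 1))
        (fun x y hxy => congrArg Not (dependsOn_coin_layer v (i + 1) hxy)))
        (dependsOn_ind (dependsOn_live i v a)) (disjoint_layer_of_time ownCoins_union_branch_time),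
      expect_not, expect_coin hi, ih (by omega) fun j hj => h j (by omega), act_succ]
    simp

/-- The joint law of the initial coin of `v`, of an observable of the branch `a`, and of the
survival of all other branches. -/
lemma expect_core {i : ℕ} (hi : i ≤ N) (hT : TreeLike G i) (h : SurvLaw G r N p ε i) {v u : V}
    {a : V ⊕ Fin r} (ha : a ∈ slots G r v u) {Q : Sample V r N → ℝ} {S : Set (Coord V r N)}
    (hQ : DependsOn Q S) (hS0 : (v, Sum.inl 0) ∉ S)
    (hS : ∀ b ∈ (slots G r v u).erase a, Disjoint S (branch G N i i v b)) :
    expect (weight r p ε N) (fun ω : Sample V r N => ind (¬(seed ω).coin v 0) *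
      (Q ω * ind (∀ b ∈ (slots G r v u).erase a, ¬arr G (seed ω) i v b))) =
      (1 - p) * (expect (weight r p ε N) Q * surv r p ε i ^ ((slots G r v u).card - 1)) := by
  have hmem : ∀ b ∈ (slots G r v u).erase a, b ∈ slots G r v v := fun b hb =>
    slots_subset _ _ (Finset.mem_of_mem_erase hb)
  simp only [ind_forall]
  have hdep : ∀ b ∈ (slots G r v u).erase a,
      DependsOn (fun ω : Sample V r N => ind (¬arr G (seed ω) i v b)) (branch G N i i v b) :=
    fun b _ => dependsOn_ind fun x y hxy => congrArg Not (dependsOn_arr i v b hxy)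
  have hprod := dependsOn_finset_prod hdep
  have hc : DependsOn (fun ω : Sample V r N => ind (¬(seed ω).coin v 0)) {(v, Sum.inl 0)} :=
    dependsOn_ind fun x y hxy => congrArg Not (dependsOn_coin' (fun _ => rfl) hxy)
  have hQP : DependsOn (fun ω => Q ω * ∏ b ∈ (slots G r v u).erase a,
      ind (¬arr G (seed ω) i v b)) (S ∪ ⋃ b ∈ (slots G r v u).erase a, branch G N i i v b) := by
    intro x y hxy
    have h1 : Q x = Q y := hQ fun k hk => hxy k (Or.inl hk)
    have h2 := hprod (x := x) (y := y) fun k hk => hxy k (Or.inr hk)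
    simp only at h2 ⊢
    rw [h1, h2]
  rw [expect_mul sum_weight hc hQP, expect_mul sum_weight hQ hprod,
    expect_finset_prod sum_weight _ hdep, Finset.prod_congr rfl fun b hb => h.expect_arr hi (hmem b hb),
    Finset.prod_const, Finset.card_erase_of_mem ha, expect_not, expect_coin (Nat.zero_le N), if_pos rfl]
  · exact fun b hb b' hb' hne => branch_disjoint hT (hmem b hb) (hmem b' hb') hne
  · rw [Set.disjoint_iUnion₂_right]
    exact hS
  · rw [Set.disjoint_singleton_left]
    rintro (hk | hk)
    · exact hS0 hk
    · simp only [Set.mem_iUnion] at hk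
      obtain ⟨b, hb, hk⟩ := hk
      exact coin_notMem_branch hT (hmem b hb) _ hk

/-- The fresh coins are independent of the state at time `i`, to which `expect_core` applies. The
set `M` is empty in the recursion for survival, and is the neighbourhood of `v` when it has to be
kept. -/
lemma expect_blue {i : ℕ} (hi : i + 1 ≤ N) (hT : TreeLike G i) (h : ∀ j ≤ i, SurvLaw G r N p ε j)
    {v u : V} {a : V ⊕ Fin r} (ha : a ∈ slots G r v u) {M : Finset V} (hM : v ∉ M) :
    expect (weight r p ε N) (fun ω : Sample V r N =>
      ind (((seed ω).coin v (i + 1) ∧ blue G (seed ω) i v u a) ∧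
        ∀ w ∈ M, ¬(seed ω).coin w (i + 1))) =
      (1 - ε) ^ M.card *
        (ε * ((1 - p) * act r p ε i * surv r p ε i ^ ((slots G r v u).card - 1))) := by
  have hmem : ∀ b ∈ slots G r v u, b ∈ slots G r v v := fun b hb => slots_subset _ _ hb
  have e : ∀ ω : Sample V r N, ind (((seed ω).coin v (i + 1) ∧ blue G (seed ω) i v u a) ∧
        ∀ w ∈ M, ¬(seed ω).coin w (i + 1)) =
      (ind ((seed ω).coin v (i + 1)) * ∏ w ∈ M, ind (¬(seed ω).coin w (i + 1))) *
        (ind (¬(seed ω).coin v 0) * (ind (live G (seed ω) i v a) *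
          ind (∀ b ∈ (slots G r v u).erase a, ¬arr G (seed ω) i v b))) := by
    intro ω
    simp only [blue, ind_and, ind_forall]
    ring
  simp only [e]
  have hcd : ∀ w : V, DependsOn (fun ω : Sample V r N => ind ((seed ω).coin w (i + 1)))
      {(w, Sum.inl ⟨i + 1, by omega⟩)} := fun w => dependsOn_ind (dependsOn_coin' fun _ => rfl)
  have hcd' : ∀ w ∈ M, DependsOn (fun ω : Sample V r N => ind (¬(seed ω).coin w (i + 1)))
      {(w, Sum.inl ⟨i + 1, by omega⟩)} := fun w _ =>
    dependsOn_ind fun x y hxy => congrArg Not (dependsOn_coin' (fun _ => rfl) hxy)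
  have hcoins : expect (weight r p ε N) (fun ω : Sample V r N => ind ((seed ω).coin v (i + 1)) *
      ∏ w ∈ M, ind (¬(seed ω).coin w (i + 1))) = ε * (1 - ε) ^ M.card := by
    rw [expect_mul sum_weight (hcd v) (dependsOn_finset_prod hcd'), expect_coin hi,
      expect_finset_prod sum_weight _ hcd',
      Finset.prod_congr rfl fun w _ => (expect_not.trans (by rw [expect_coin hi])),
      Finset.prod_const]
    · simp
    · intro w _ w' _ hne
      rw [Set.disjoint_singleton]
      exact fun h => hne (congrArg Prod.fst h)
    · rw [Set.disjoint_iUnion₂_right]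
      intro w hw
      rw [Set.disjoint_singleton]
      intro h
      have hvw : v = w := congrArg Prod.fst h
      exact hM (hvw ▸ hw)
  have hlayer : DependsOn (fun ω : Sample V r N => ind ((seed ω).coin v (i + 1)) *
      ∏ w ∈ M, ind (¬(seed ω).coin w (i + 1))) (layer V r N (i + 1)) := by
    intro x y hxy
    have h1 : ∀ w, (seed x).coin w (i + 1) = (seed y).coin w (i + 1) := fun w =>
      dependsOn_coin_layer w (i + 1) hxy
    simp only [h1]
  have hcore : DependsOn (fun ω : Sample V r N => ind (¬(seed ω).coin v 0) *
      (ind (live G (seed ω) i v a) *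
        ind (∀ b ∈ (slots G r v u).erase a, ¬arr G (seed ω) i v b)))
      {k | ∀ l : Fin (N + 1), k.2 = Sum.inl l → (l : ℕ) ≤ i} := by
    intro x y hxy
    have h1 : (seed x).coin v 0 = (seed y).coin v 0 :=
      dependsOn_coin' (S := {k | ∀ l : Fin (N + 1), k.2 = Sum.inl l → (l : ℕ) ≤ i})
        (fun h l hl => by obtain rfl := Sum.inl.inj hl; exact Nat.zero_le i) hxy
    have h2 : live G (seed x) i v a = live G (seed y) i v a :=
      dependsOn_live i v a fun k hk => hxy k (ownCoins_union_branch_time k hk)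
    have h3 : ∀ b, arr G (seed x) i v b = arr G (seed y) i v b := fun b =>
      dependsOn_arr i v b fun k hk => hxy k (branch_time hk)
    simp only [h1, h2, h3]
  rw [expect_mul sum_weight hlayer hcore (disjoint_layer_of_time fun k hk => hk), hcoins,
    expect_core (by omega) hT (h i le_rfl) ha (dependsOn_ind (dependsOn_live i v a)) ?_ ?_,
    expect_live (by omega) h (hmem a ha)]
  · ring
  · rintro (hk | ⟨l, hl, h1, -⟩)
    · exact coin_notMem_branch hT (hmem a ha) _ hk
    · obtain rfl := Sum.inl.inj (congrArg Prod.snd hl)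
      simp at h1
  · intro b hb
    rw [Finset.mem_erase] at hb
    rw [Set.disjoint_union_left]
    refine ⟨branch_disjoint hT (hmem a ha) (hmem b hb.2) hb.1.symm, ?_⟩
    rw [Set.disjoint_left]
    rintro k ⟨l, rfl, -, -⟩
    exact coin_notMem_branch hT (hmem b hb.2) l

/-- Induction on time: the `r - 1` slots, each the only explored one with probability `(1 - p) * act
* surv ^ (r - 2)` in its blue form, together give the decrement `ε * rate * act`. Missing slots have
the same law as real ones, so the degree of the vertex plays no role. -/
lemma survLaw (hr : 3 ≤ r) (hd : ∀ v, G.degree v ≤ r) (hT : TreeLike G N) {i : ℕ} (hi : i ≤ N) :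
    SurvLaw G r N p ε i := by
  have key : ∀ i ≤ N, ∀ j ≤ i, SurvLaw G r N p ε j := by
    intro i
    induction i with
    | zero =>
      intro _ j hj v u _
      obtain rfl : j = 0 := by omega
      refine expect_not.trans ?_
      have := expect_coin (r := r) (p := p) (ε := ε) (Nat.zero_le N) v
      rw [if_pos rfl] at this
      rw [surv_zero]
      exact congrArg (1 - ·) this
    | succ i ih =>
      intro hi j hj
      rcases Nat.lt_or_ge j (i + 1) with hlt | hge
      · exact ih (by omega) j (by omega)
      obtain rfl : j = i + 1 := by omega
      intro v u hvu
      have hih := ih (by omega)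
      have hb : ∀ a ∈ slots G r v u, expect (weight r p ε N) (fun ω : Sample V r N =>
          ind ((seed ω).coin v (i + 1) ∧ blue G (seed ω) i v u a)) =
          ε * ((1 - p) * act r p ε i * surv r p ε i ^ (r - 2)) := by
        intro a ha
        have := expect_blue hi (hT.mono (by omega)) hih ha (Finset.notMem_empty v)
        rw [card_slots_of_adj (hd v) hvu, show r - 1 - 1 = r - 2 by omega] at this
        simpa using this
      simp only [ind_not_msg_succ]
      rw [expect_sub, expect_sum, Finset.sum_congr rfl hb, Finset.sum_const,
        card_slots_of_adj (hd v) hvu, hih i le_rfl v u hvu, surv_succ, rate, nsmul_eq_mul,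
        Nat.cast_sub (by omega)]
      push_cast
      ring
  exact key i hi i le_rfl

/-- A union bound over the next vertex `w` of the path. The continuation from `w` and the silence of
the remaining slots live on disjoint branches, hence the product. -/
lemma expect_deep_le (hr : 3 ≤ r) (hp0 : 0 < p) (hp : p < 1) (hε : 0 < ε)
    (hε1 : ε * ((r : ℝ) - 1) < 1) (hd : ∀ v, G.degree v ≤ r) {m : ℕ} (hT : TreeLike G (N + m))
    {v u : V} {B : ℝ} (hB : ∀ w, G.Adj v w →
      expect (weight r p ε N) (fun ω : Sample V r N => ind (deep G (seed ω) N m w v)) ≤ B) :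
    expect (weight r p ε N) (fun ω : Sample V r N => ind (deep G (seed ω) N (m + 1) v u)) ≤
      ((G.neighborFinset v).erase u).card *
        ((1 - p) * (B * surv r p ε N ^ ((slots G r v u).card - 1))) := by
  have hmem : ∀ b ∈ slots G r v u, b ∈ slots G r v v := fun b hb => slots_subset _ _ hb
  refine (expect_mono (weight_nonneg hr hp0 hp hε hε1) fun ω => ind_exists_le _ _).trans ?_
  rw [expect_sum, ← nsmul_eq_mul]
  refine Finset.sum_le_card_nsmul _ _ _ fun w hw => ?_
  have hw' : Sum.inl w ∈ slots G r v u := inl_mem_slots.2 (by simpa using hw)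
  simp only [ind_and]
  rw [expect_core le_rfl (hT.mono (by omega)) (survLaw hr hd (hT.mono (by omega)) le_rfl) hw'
    (dependsOn_ind (dependsOn_deep m w v))
    (coin_notMem_branch (t := N) hT (hmem _ hw') 0)
    fun b hb => (branch_disjoint (t := N) hT (hmem _ hw') (hmem b (Finset.mem_of_mem_erase hb))
      (Finset.ne_of_mem_erase hb).symm).mono_right (branch_mono (by omega) le_rfl _ _)]
  have h1 : 0 ≤ 1 - p := by linarith
  have h2 := (fracs_bounds hr hp0 hp hε hε1 N).1
  have h3 := hB w (inl_mem_slots.1 hw').2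
  gcongr

/-- Each step has at most `r - 1` continuations, each of cost `(1 - p) * surv ^ (r - 2)`; the
product is `rate`. -/
lemma expect_deep_adj_le (hr : 3 ≤ r) (hp0 : 0 < p) (hp : p < 1) (hε : 0 < ε)
    (hε1 : ε * ((r : ℝ) - 1) < 1) (hd : ∀ v, G.degree v ≤ r) {m : ℕ} (hT : TreeLike G (N + m))
    {v u : V} (hvu : G.Adj v u) :
    expect (weight r p ε N) (fun ω : Sample V r N => ind (deep G (seed ω) N m v u)) ≤
      rate r p (surv r p ε N) ^ m := by
  induction m generalizing v u with
  | zero =>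
    have : expect (weight r p ε N) (fun _ : Sample V r N => (1 : ℝ)) = 1 :=
      expect_const sum_weight 1
    simp [deep, ind, this]
  | succ m ih =>
    have hT' : TreeLike G (N + m) := hT.mono (by omega)
    have h := expect_deep_le (u := u) hr hp0 hp hε hε1 hd hT' (v := v) fun w hw => ih hT' hw.symm
    refine h.trans ?_
    have hf := (fracs_bounds hr hp0 hp hε hε1 N).1
    have hcard : (((G.neighborFinset v).erase u).card : ℝ) ≤ (r : ℝ) - 1 := by
      rw [Finset.card_erase_of_mem (by simpa using hvu), SimpleGraph.card_neighborFinset_eq_degree]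
      have hpos : 0 < G.degree v := (G.degree_pos_iff_exists_adj v).2 ⟨u, hvu⟩
      rw [Nat.cast_sub hpos]
      have : (G.degree v : ℝ) ≤ r := by exact_mod_cast hd v
      push_cast
      linarith
    rw [card_slots_of_adj (hd v) hvu, show r - 1 - 1 = r - 2 by omega]
    have h1 : 0 ≤ 1 - p := by linarith
    have h2 := pow_pos (rate_pos hr hp hf) m
    calc _ ≤ ((r : ℝ) - 1) * ((1 - p) *
          (rate r p (surv r p ε N) ^ m * surv r p ε N ^ (r - 2))) := by gcongr
      _ = rate r p (surv r p ε N) ^ m * ((1 - p) * ((r : ℝ) - 1) * surv r p ε N ^ (r - 2)) := by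
        ring
      _ = _ := by rw [pow_succ, ← rate]

lemma expect_deep_self_le (hr : 3 ≤ r) (hp0 : 0 < p) (hp : p < 1) (hε : 0 < ε)
    (hε1 : ε * ((r : ℝ) - 1) < 1) (hd : ∀ v, G.degree v ≤ r) {m : ℕ} (hT : TreeLike G (N + m))
    (v : V) :
    expect (weight r p ε N) (fun ω : Sample V r N => ind (deep G (seed ω) N (m + 1) v v)) ≤
      r * rate r p (surv r p ε N) ^ m := by
  have h := expect_deep_le (u := v) hr hp0 hp hε hε1 hd hT (v := v) fun w hw =>
    expect_deep_adj_le hr hp0 hp hε hε1 hd hT hw.symm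
  refine h.trans ?_
  obtain ⟨hf, hh, hs⟩ := fracs_bounds hr hp0 hp hε hε1 N
  have hcard : (((G.neighborFinset v).erase v).card : ℝ) ≤ r := by
    rw [Finset.erase_eq_of_notMem (by simp), SimpleGraph.card_neighborFinset_eq_degree]
    exact_mod_cast hd v
  have h1 : 0 ≤ 1 - p := by linarith
  have h2 := pow_pos (rate_pos hr hp hf) m
  have h3 : surv r p ε N ^ ((slots G r v v).card - 1) ≤ 1 := pow_le_one₀ hf.le (by linarith)
  -- The first step has up to `r` continuations; its other factors are merely bounded by `1`, which
  -- is why the exponent is `m` for a path of length `m + 1`.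
  calc _ ≤ (r : ℝ) * (1 * (rate r p (surv r p ε N) ^ m * 1)) := by gcongr; linarith
    _ = _ := by ring

lemma expect_white (hr : 3 ≤ r) (hd : ∀ v, G.degree v ≤ r) (hT : TreeLike G N) (v : V) :
    expect (weight r p ε N) (fun ω : Sample V r N => ind (white G (seed ω) N v v)) =
      (1 - p) * surv r p ε N ^ r := by
  have hcard := card_slots_self (hd v)
  obtain ⟨a, ha⟩ : (slots G r v v).Nonempty := by
    rw [← Finset.card_pos]; omega
  have h := survLaw (p := p) (ε := ε) hr hd hT le_rfl
  have e : ∀ ω : Sample V r N, ind (white G (seed ω) N v v) = ind (¬(seed ω).coin v 0) *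
      (ind (¬arr G (seed ω) N v a) *
        ind (∀ b ∈ (slots G r v v).erase a, ¬arr G (seed ω) N v b)) := by
    intro ω
    rw [white, ind_and, ind_forall, ind_forall,
      Finset.mul_prod_erase _ (fun a => ind (¬arr G (seed ω) N v a)) ha]
  simp only [e]
  rw [expect_core le_rfl hT h ha (S := branch G N N N v a)
    (dependsOn_ind fun x y hxy => congrArg Not (dependsOn_arr N v a hxy))
    (coin_notMem_branch hT ha _) fun b hb => branch_disjoint hT ha (Finset.mem_of_mem_erase hb)
      (Finset.ne_of_mem_erase hb).symm, h.expect_arr le_rfl ha, hcard, ← pow_succ',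
    show r - 1 + 1 = r by omega]

lemma expect_kept_zero_ge (hp0 : 0 < p) (hp : p < 1) (hd : ∀ v, G.degree v ≤ r) (v : V) :
    p * (1 - p) ^ r ≤
      expect (weight r p ε N) (fun ω : Sample V r N => ind (kept G (seed ω) 0 v)) := by
  have hcd : DependsOn (fun ω : Sample V r N => ind ((seed ω).coin v 0))
      {(v, Sum.inl 0)} := dependsOn_ind (dependsOn_coin' fun _ => rfl)
  have hcd' : ∀ w ∈ G.neighborFinset v, DependsOn (fun ω : Sample V r N =>
      ind (¬(seed ω).coin w 0)) {(w, Sum.inl 0)} := fun w _ =>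
    dependsOn_ind fun x y hxy => congrArg Not (dependsOn_coin' (fun _ => rfl) hxy)
  simp only [kept, sel, ind_and, ind_forall]
  rw [expect_mul sum_weight hcd (dependsOn_finset_prod hcd'), expect_coin (Nat.zero_le N),
    expect_finset_prod sum_weight _ hcd',
    Finset.prod_congr rfl fun w _ => (expect_not.trans (by rw [expect_coin (Nat.zero_le N)])),
    Finset.prod_const, if_pos rfl, SimpleGraph.card_neighborFinset_eq_degree]
  · exact mul_le_mul_of_nonneg_left
      (pow_le_pow_of_le_one (by linarith) (by linarith) (hd v)) hp0.le
  · intro w _ w' _ hne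
    rw [Set.disjoint_singleton]
    exact fun h => hne (congrArg Prod.fst h)
  · rw [Set.disjoint_iUnion₂_right]
    intro w hw
    rw [Set.disjoint_singleton]
    intro h
    have : v = w := congrArg Prod.fst h
    subst this
    simp at hw

lemma expect_kept_succ_ge (hr : 3 ≤ r) (hp0 : 0 < p) (hp : p < 1) (hε : 0 < ε)
    (hε1 : ε * ((r : ℝ) - 1) < 1) (hd : ∀ v, G.degree v ≤ r) (hT : TreeLike G N) {i : ℕ}
    (hi : i + 1 ≤ N) (v : V) :
    (1 - ε) ^ r * (ε * ((1 - p) * r * act r p ε i * surv r p ε i ^ (r - 1))) ≤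
      expect (weight r p ε N) (fun ω : Sample V r N => ind (kept G (seed ω) (i + 1) v)) := by
  have hε2 : ε < 1 := by nlinarith [two_le_cast_sub_one hr]
  obtain ⟨hf, hh, -⟩ := fracs_bounds hr hp0 hp hε hε1 i
  have e : ∀ ω : Sample V r N, ind (kept G (seed ω) (i + 1) v) =
      ∑ a ∈ slots G r v v, ind (((seed ω).coin v (i + 1) ∧ blue G (seed ω) i v v a) ∧
        ∀ w ∈ G.neighborFinset v, ¬(seed ω).coin w (i + 1)) := by
    intro ω
    rw [← ind_exists _ _ fun a _ b hb ha hb' => blue_unique hb ha.1.2 hb'.1.2]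
    congr 1
    simp only [kept, sel, eq_iff_iff]
    exact ⟨fun ⟨⟨a, ha, h⟩, h'⟩ => ⟨a, ha, h, h'⟩, fun ⟨a, ha, h, h'⟩ => ⟨⟨a, ha, h⟩, h'⟩⟩
  simp only [e]
  rw [expect_sum, Finset.sum_congr rfl fun a ha => expect_blue hi (hT.mono (by omega))
    (fun j hj => survLaw hr hd hT (by omega)) ha (M := G.neighborFinset v) (by simp),
    Finset.sum_const, card_slots_self (hd v), nsmul_eq_mul,
    SimpleGraph.card_neighborFinset_eq_degree]
  -- Only real neighbours have coins that can collide, so a smaller degree only helps.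
  have h1 : (1 - ε) ^ r ≤ (1 - ε) ^ G.degree v :=
    pow_le_pow_of_le_one (by linarith) (by linarith) (hd v)
  have h2 : 0 ≤ ε * ((1 - p) * r * act r p ε i * surv r p ε i ^ (r - 1)) := by
    have : 0 ≤ 1 - p := by linarith
    positivity
  refine (mul_le_mul_of_nonneg_right h1 h2).trans (le_of_eq ?_)
  ring

/-- A graph that looks like a tree up to distance `N + k` has an induced forest of the density
found by the exploration process. -/
theorem density_mul_card_le_tau (hr : 3 ≤ r) (hp0 : 0 < p) (hp : p < 1) (hε : 0 < ε)
    (hε1 : ε * ((r : ℝ) - 1) < 1) (hd : ∀ v, G.degree v ≤ r) {k : ℕ} (hT : TreeLike G (N + k)) :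
    density r p ε N k * Fintype.card V ≤ tau G := by
  classical
  have hTN : TreeLike G N := hT.mono (by omega)
  have hv : ∀ v : V, density r p ε N k ≤ expect (weight r p ε N)
      (fun ω : Sample V r N => ind (v ∈ chosen G (seed ω) N (k + 1))) := by
    intro v
    refine le_trans ?_ (expect_mono (weight_nonneg hr hp0 hp hε hε1)
      fun ω => le_ind_mem_chosen N (k + 1) v)
    rw [expect_add, expect_sub, expect_sum, Finset.sum_range_succ', expect_white hr hd hTN]
    have h1 := expect_deep_self_le hr hp0 hp hε hε1 hd hT v
    have h2 := expect_kept_zero_ge (N := N) (ε := ε) hp0 hp hd v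
    have h3 : (1 - ε) ^ r * ∑ i ∈ Finset.range N,
        ε * ((1 - p) * r * act r p ε i * surv r p ε i ^ (r - 1)) ≤
        ∑ i ∈ Finset.range N, expect (weight r p ε N)
          (fun ω : Sample V r N => ind (kept G (seed ω) (i + 1) v)) := by
      rw [Finset.mul_sum]
      exact Finset.sum_le_sum fun i hi =>
        expect_kept_succ_ge hr hp0 hp hε hε1 hd hTN (by rw [Finset.mem_range] at hi; omega) v
    unfold density
    linarith
  -- First moment method: some outcome has at least the expected number of chosen vertices.
  obtain ⟨ω, hω⟩ := exists_expect_le (weight_nonneg hr hp0 hp hε hε1) sum_weight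
    (fun ω : Sample V r N => ∑ v, ind (v ∈ chosen G (seed ω) N (k + 1)))
  set S : Finset V := Finset.univ.filter fun v => v ∈ chosen G (seed ω) N (k + 1) with hS
  have hcard : ∑ v, ind (v ∈ chosen G (seed ω) N (k + 1)) = (S.card : ℝ) := by
    rw [hS, Finset.card_filter]
    push_cast
    refine Finset.sum_congr rfl fun v _ => ?_
    unfold ind
    congr
  have hac : (G.induce (S : Set V)).IsAcyclic := by
    have : (S : Set V) = chosen G (seed ω) N (k + 1) := by ext; simp [hS]
    rw [this]
    exact isAcyclic_chosen N (k + 1)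
  have hτ : (S.card : ℝ) ≤ tau G := by exact_mod_cast card_le_tau hac
  refine le_trans ?_ hτ
  rw [← hcard]
  refine le_trans ?_ hω
  rw [expect_sum]
  calc density r p ε N k * Fintype.card V = ∑ _v : V, density r p ε N k := by
        rw [Finset.sum_const, nsmul_eq_mul, Finset.card_univ, mul_comm]
    _ ≤ _ := Finset.sum_le_sum fun v _ => hv v

end law

/-! ### Conclusion -/

/-- Graphs of bounded degree and large girth have induced forests of density close to `ξ(r)`. -/
theorem exists_girth_xi_le_tau.{u} {r : ℕ} (hr : 3 ≤ r) {δ : ℝ} (hδ : 0 < δ) :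
    ∃ g : ℕ, 0 < g ∧ ∀ (V : Type u) [Fintype V] (G : SimpleGraph V) [DecidableRel G.Adj],
      G.maxDegree ≤ r → (g : ℕ∞) ≤ G.egirth →
        (xi r - δ) * (Fintype.card V : ℝ) ≤ (tau G : ℝ) := by
  -- Half of `δ` pays for a `p` that nearly attains the supremum, the other half for the
  -- discretization. All parameters are fixed before the graph, so the girth depends only on `δ` and
  -- `r`.
  obtain ⟨c, ⟨p, ⟨hp0, hp⟩, hc⟩, hxc, -⟩ :=
    (isLUB_xi hr).exists_between (show xi r - δ / 2 < xi r by linarith)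
  obtain ⟨φ, hφ0, hφ1, hφ⟩ := exists_profile_eq_zero hr hp0 hp
  rw [isXi_iff hr hp0 hp hφ0 hφ1 hφ] at hc
  obtain ⟨ε, hε, hε1, N, k, hdens⟩ := exists_density_ge hr hp0 hp hφ0 hφ1 hφ (half_pos hδ)
  -- The least girth allowed by `treeLike_of_le_egirth` for branches of depth `N + k`.
  refine ⟨2 * (N + k) + 3, by omega, fun V _ G _ hdeg hg => ?_⟩
  classical
  have h := density_mul_card_le_tau (N := N) (k := k) hr hp0 hp hε hε1
    (fun v => (G.degree_le_maxDegree v).trans hdeg) (treeLike_of_le_egirth hg (by omega))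
  refine le_trans ?_ h
  gcongr
  linarith

end InducedForest

end

theorem corollary1p1 (r : ℕ) (hr : 3 ≤ r) :
    (∀ p₀ ∈ Set.Ioo (0 : ℝ) 1, ∃! c : ℝ, InducedForest.IsXi r p₀ c) ∧
    IsLUB (InducedForest.xiValues r) (InducedForest.xi r) ∧
    (∀ δ : ℝ, 0 < δ → ∃ g : ℕ, 0 < g ∧
      ∀ (V : Type*) [Fintype V] (G : SimpleGraph V) [DecidableRel G.Adj],
        G.maxDegree ≤ r → (g : ℕ∞) ≤ G.egirth →
          (InducedForest.xi r - δ) * (Fintype.card V : ℝ) ≤ (InducedForest.tau G : ℝ)) ∧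
    (r ≤ 10 → ∃ p₀ ∈ Set.Ioo (0 : ℝ) 1, ∃ c : ℝ, InducedForest.IsXi r p₀ c ∧
      InducedForest.tableXi r ≤ c ∧ c < InducedForest.tableXi r + 0.0001) :=
  ⟨fun _ hp => InducedForest.existsUnique_isXi hr hp.1 hp.2, InducedForest.isLUB_xi hr,
    fun _ hδ => InducedForest.exists_girth_xi_le_tau hr hδ, InducedForest.exists_isXi_table hr⟩
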